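/- **Theorem 1 (Optimal Gill–Levit bound).** Let $\Theta$ be a $p$-dimensional smooth manifold (Hausdorff, second countable), possibly with boundary or corners, with a smooth Riemannian metric $g$, volume $\epsilon=\sqrt{|g|}\,d^p\theta$ and covariant derivative $\nabla$. Let $\{f(x|\theta)\}$ be a family of probability densities with respect to a measure $\mu$, differentiable in $\theta$, whose Fisher information $F_{ab}(\theta)=\int(\partial_a\ln f)(\partial_b\ln f)f\,d\mu$ is finite and continuous on the interior of $\Theta$; let $n\in\{0,1,2,\dots\}$ be the number of observations, $\rho\ge 0$ a prior probability density with respect to $\epsilon$, positive and $C^1$ on the interior, and $\beta:\Theta\to\mathbb R$ differentiable on the interior with $u_a=\partial_a\beta$ not identically zero there. Write $\langle h\rangle=\int h\rho\,\epsilon$ and $\langle v,u\rangle_\rho=\int v^au_a\,\rho\,\epsilon$. Let $V$ be the set of vector fields $v$, $C^1$ on the interior, such that $\rho v$ vanishes on the boundary, and $\langle\mathsf F\rangle$ and $\langle\mathsf P\rangle$ are finite, where $\mathsf F=v^aF_{ab}v^b$ and $\mathsf P=\big[\tfrac1\rho\nabla_a(\rho v^a)\big]^2$. Here "$\rho v$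 vanishes on the boundary" means that $\rho v$ is continuous on $\Theta$ and zero on $\partial\Theta$ and, if $\Theta$ is not compact, that its flux vanishes at infinity: there are compactly supported $C^1$ functions $\chi_k:\Theta\to[0,1]$ with $\chi_k\to1$ pointwise and $\int|\rho v^a\partial_a\chi_k|\,\epsilon\to0$ (for compact $\Theta$ take $\chi_k=1$). For $v\in V$ with $\mathsf A=v^au_a$ satisfying $\langle|\mathsf A|\rangle<\infty$ and $n\langle\mathsf F\rangle+\langle\mathsf P\rangle\neq0$ the Gill–Levit bound is $$\mathsf B(v)=\frac{\langle\mathsf A\rangle^2}{n\langle\mathsf F\rangle+\langle\mathsf P\rangle}.$$ For a vector field $v$ such that $v$ and $\tfrac1\rho\nabla_b(\rho v^b)$ are $C^1$ on the interior, put there $$(Lv)_a=nF_{ab}v^b-\nabla_a\Big[\tfrac1\rho\nabla_b(\rho v^b)\Big].$$ (i) $L$ is linear. For all $v,w\in V$ to which $L$ applies, $\langle v,Lw\rangle_\rho=\langle w,Lv\rangle_\rho$ whenever both integrals converge absolutely ($L$ is self-adjoint in the sense of being symmetric), and $\langle v,Lv\rangle_\rho\ge0$ whenever this integral converges absolutely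 ($L$ is positive-semidefinite). (ii) Suppose that $u$ is in the range of $L$. That is, there is a field $w\in V$ to which $L$ applies, with $Lw=u$ on the interior and $\langle u,w\rangle_\rho$ absolutely convergent; write $w=L^{-1}u$ for any such field. Then, for every choice of $L^{-1}u$, $$\max_v\mathsf B(v)=\langle u,L^{-1}u\rangle_\rho=:\mathsf B_{\max},$$ the maximum being over all $v$ for which $\mathsf B(v)$ is defined as above. (iii) Under the same assumption, a vector field $v$ attains this maximum (is least favorable) if and only if $v\propto L^{-1}u$, that is, $v=c\,w$ for some real $c\neq0$ and some choice $w$ of $L^{-1}u$. -/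

import Mathlib

open Set Filter Topology MeasureTheory Bundle
open scoped Manifold ContDiff

noncomputable section

namespace GillLevit

variable {p : ℕ} {H : Type*} [TopologicalSpace H]
  {I : ModelWithCorners ℝ (EuclideanSpace ℝ (Fin p)) H}
  {Θ : Type*} [TopologicalSpace Θ] [ChartedSpace H Θ]

variable (I Θ) in
/-- Vector fields on `Θ`, with (contravariant) components `v^a`. -/
abbrev VField := (θ : Θ) → TangentSpace I θ

variable (I Θ) in
/-- Covector fields on `Θ`, with (covariant) components `u_a`. -/
abbrev CField := (θ : Θ) → (TangentSpace I θ →L[ℝ] ℝ)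

variable (I Θ) in
/-- Smooth Riemannian metrics on `Θ`. -/
abbrev Metric [IsManifold I ∞ Θ] :=
  ContMDiffRiemannianMetric I ∞ (EuclideanSpace ℝ (Fin p)) (fun θ : Θ => TangentSpace I θ)

/-! ### Riemannian volume and divergence in charts -/

variable (I) in
/-- The coordinate vector `∂_a` of the preferred chart at `x`, at the point with coordinates `y`. -/
def coordVec (x : Θ) (y : EuclideanSpace ℝ (Fin p)) (a : Fin p) :
    TangentSpace I ((extChartAt I x).symm y) :=
  mfderivWithin 𝓘(ℝ, EuclideanSpace ℝ (Fin p)) I (extChartAt I x).symm (range I) y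
    (EuclideanSpace.single a (1 : ℝ))

/-- `√|g|` in the preferred chart at `x`, at the point with coordinates `y`. -/
def sqrtDet [IsManifold I ∞ Θ] (g : Metric I Θ) (x : Θ) (y : EuclideanSpace ℝ (Fin p)) : ℝ :=
  Real.sqrt (Matrix.det (Matrix.of fun a b : Fin p =>
    g.inner ((extChartAt I x).symm y) (coordVec I x y a) (coordVec I x y b)))

/-- The components of the vector field `w` in the preferred chart at `x`, at the point with
coordinates `y`. -/
def coordField (w : VField I Θ) (x : Θ) (y : EuclideanSpace ℝ (Fin p)) :
    EuclideanSpace ℝ (Fin p) :=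
  mfderiv I 𝓘(ℝ, EuclideanSpace ℝ (Fin p)) (extChartAt I x) ((extChartAt I x).symm y)
    (w ((extChartAt I x).symm y))

/-- The measure `√|g| d^pθ` on the domain of the preferred chart at `x`, as a measure on `Θ`. -/
def chartVolume [IsManifold I ∞ Θ] [MeasurableSpace Θ] (g : Metric I Θ) (x : Θ) : Measure Θ :=
  Measure.map (extChartAt I x).symm
    ((volume.restrict (extChartAt I x).target).withDensity
      fun y => ENNReal.ofReal (sqrtDet g x y))

/-- The Riemannian volume `ε`. The measures `√|g| d^pθ` of the charts agree on overlaps; their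
supremum in the lattice of measures is the measure that they glue to. -/
def riemVolume [IsManifold I ∞ Θ] [MeasurableSpace Θ] (g : Metric I Θ) : Measure Θ :=
  ⨆ x : Θ, chartVolume g x

/-- The Riemannian divergence `∇_a w^a = |g|^{-1/2} ∂_a (|g|^{1/2} w^a)`. -/
def divergence [IsManifold I ∞ Θ] (g : Metric I Θ) (w : VField I Θ) (θ : Θ) : ℝ :=
  (sqrtDet g θ (extChartAt I θ θ))⁻¹ * ∑ a : Fin p,
    fderivWithin ℝ (fun y => sqrtDet g θ y * coordField w θ y a) (range I) (extChartAt I θ θ)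
      (EuclideanSpace.single a (1 : ℝ))

/-- The differential of a real function on `Θ`, as a covector field. -/
def dif (h : Θ → ℝ) : CField I Θ := fun θ => mfderiv I 𝓘(ℝ, ℝ) h θ

/-! ### The statistical model -/

variable (I) in
/-- The Fisher information tensor `F_{ab} = ∫ (∂_a ln f) (∂_b ln f) f dμ` of the family of
densities `f θ` at the point `θ`, evaluated on two tangent vectors. -/
def fisher {X : Type*} [MeasurableSpace X] (μ : Measure X) (f : Θ → X → ℝ) (θ : Θ)
    (a b : TangentSpace I θ) : ℝ :=
  ∫ x, dif (I := I) (fun θ' => Real.log (f θ' x)) θ a *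
    dif (I := I) (fun θ' => Real.log (f θ' x)) θ b * f θ x ∂μ

variable (I) in
/-- A family of probability densities that is differentiable in the parameter, with a finite
Fisher information that depends continuously on the parameter, on the interior of `Θ`. -/
structure IsRegularModel [IsManifold I ∞ Θ] {X : Type*} [MeasurableSpace X] (μ : Measure X) (f : Θ → X → ℝ) :
    Prop where
  nonneg : ∀ θ x, 0 ≤ f θ x
  measurable : ∀ θ, Measurable (f θ)
  normalized : ∀ θ, ∫⁻ x, ENNReal.ofReal (f θ x) ∂μ = 1
  differentiable : ∀ θ ∈ I.interior Θ, ∀ᵐ x ∂μ, MDifferentiableAt I 𝓘(ℝ, ℝ) (fun θ' => f θ' x) θ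
  finite_information : ∀ θ ∈ I.interior Θ, ∀ a : TangentSpace I θ,
    Integrable (fun x => dif (I := I) (fun θ' => Real.log (f θ' x)) θ a ^ 2 * f θ x) μ
  continuous_information : ∀ V : VField I Θ,
    ContinuousOn (fun θ => (⟨θ, V θ⟩ : TangentBundle I Θ)) (I.interior Θ) →
    ContinuousOn (fun θ => fisher I μ f θ (V θ) (V θ)) (I.interior Θ)

/-- A prior probability density with respect to the Riemannian volume, positive and continuously
differentiable on the interior of `Θ`. -/
structure IsPriorDensity [IsManifold I ∞ Θ] [MeasurableSpace Θ] (g : Metric I Θ) (ρ : Θ → ℝ) :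
    Prop where
  nonneg : ∀ θ, 0 ≤ ρ θ
  pos : ∀ θ ∈ I.interior Θ, 0 < ρ θ
  smooth : ContMDiffOn I 𝓘(ℝ, ℝ) 1 ρ (I.interior Θ)
  normalized : ∫⁻ θ, ENNReal.ofReal (ρ θ) ∂(riemVolume g) = 1

/-! ### The Gill-Levit bound and the operator `L` -/

/-- The integral of `h ρ` is defined: `∫ |h| ρ ε < ∞`. -/
def PriorIntegrable [IsManifold I ∞ Θ] [MeasurableSpace Θ] (g : Metric I Θ) (ρ h : Θ → ℝ) : Prop :=
  Integrable (fun θ => h θ * ρ θ) (riemVolume g)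

/-- The prior expectation `⟨h⟩ = ∫ h ρ ε`. -/
def priorMean [IsManifold I ∞ Θ] [MeasurableSpace Θ] (g : Metric I Θ) (ρ h : Θ → ℝ) : ℝ :=
  ∫ θ, h θ * ρ θ ∂(riemVolume g)

/-- The inner product `⟨v, u⟩_ρ = ∫ v^a u_a ρ ε`, of a field with upper and one with lower
index. -/
def innerρ [IsManifold I ∞ Θ] [MeasurableSpace Θ] (g : Metric I Θ) (ρ : Θ → ℝ)
    (v : VField I Θ) (u : CField I Θ) : ℝ :=
  priorMean g ρ (fun θ => u θ (v θ))

/-- `(1/ρ) ∇_a (ρ v^a)`. -/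
def divρ [IsManifold I ∞ Θ] (g : Metric I Θ) (ρ : Θ → ℝ) (v : VField I Θ) (θ : Θ) : ℝ :=
  (1 / ρ θ) * divergence g (fun θ' => ρ θ' • v θ') θ

/-- `(L v)_a = n F_{ab} v^b - ∇_a [(1/ρ) ∇_b (ρ v^b)]`, evaluated on a tangent vector. -/
def opL [IsManifold I ∞ Θ] {X : Type*} [MeasurableSpace X] (μ : Measure X) (f : Θ → X → ℝ)
    (n : ℕ) (g : Metric I Θ) (ρ : Θ → ℝ) (v : VField I Θ) (θ : Θ) (a : TangentSpace I θ) : ℝ :=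
  n * fisher I μ f θ a (v θ) - dif (I := I) (divρ g ρ v) θ a

/-- `ρ v` vanishes on the boundary: it is continuous up to the boundary of `Θ` and zero there,
and, where `Θ` is not compact, it vanishes at infinity in the sense that its flux does: there are
compactly supported cutoffs `χ k`, tending to `1`, such that `∫ |ρ v^a ∂_a (χ k)| ε` tends
to `0`. On a compact `Θ` the second condition holds with `χ k = 1`. -/
structure VanishesOnBoundary [IsManifold I ∞ Θ] [MeasurableSpace Θ] (g : Metric I Θ) (ρ : Θ → ℝ)
    (v : VField I Θ) : Prop where
  continuous : Continuous (fun θ => (⟨θ, ρ θ • v θ⟩ : TangentBundle I Θ))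
  boundary : ∀ θ ∈ I.boundary Θ, ρ θ • v θ = 0
  infinity : ∃ χ : ℕ → Θ → ℝ,
    (∀ k, ContMDiff I 𝓘(ℝ, ℝ) 1 (χ k)) ∧ (∀ k, HasCompactSupport (χ k)) ∧
    (∀ k θ, χ k θ ∈ Icc (0 : ℝ) 1) ∧ (∀ θ, Tendsto (fun k => χ k θ) atTop (𝓝 1)) ∧
    Tendsto (fun k => ∫⁻ θ, ENNReal.ofReal |dif (I := I) (χ k) θ (ρ θ • v θ)| ∂(riemVolume g))
      atTop (𝓝 0)

/-- The vector fields that enter the Gill-Levit bounds: continuously differentiable on the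
interior, with `ρ v` vanishing on the boundary and with finite `⟨F⟩` and `⟨P⟩`. -/
structure IsField [IsManifold I ∞ Θ] [MeasurableSpace Θ] {X : Type*} [MeasurableSpace X]
    (μ : Measure X) (f : Θ → X → ℝ) (g : Metric I Θ) (ρ : Θ → ℝ) (v : VField I Θ) : Prop where
  smooth : ContMDiffOn I I.tangent 1 (fun θ => (⟨θ, v θ⟩ : TangentBundle I Θ)) (I.interior Θ)
  vanishes : VanishesOnBoundary g ρ v
  finite_F : PriorIntegrable g ρ (fun θ => fisher I μ f θ (v θ) (v θ))
  finite_P : PriorIntegrable g ρ (fun θ => divρ g ρ v θ ^ 2)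

/-- The vector fields to which `L` can be applied: `v` and `(1/ρ) ∇_a (ρ v^a)` are continuously
differentiable on the interior. -/
structure LDiff [IsManifold I ∞ Θ] (g : Metric I Θ) (ρ : Θ → ℝ) (v : VField I Θ) : Prop where
  smooth : ContMDiffOn I I.tangent 1 (fun θ => (⟨θ, v θ⟩ : TangentBundle I Θ)) (I.interior Θ)
  smooth_div : ContMDiffOn I 𝓘(ℝ, ℝ) 1 (divρ g ρ v) (I.interior Θ)

/-- The denominator `n ⟨F⟩ + ⟨P⟩` of the Gill-Levit bound. -/
def denom [IsManifold I ∞ Θ] [MeasurableSpace Θ] {X : Type*} [MeasurableSpace X]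
    (μ : Measure X) (f : Θ → X → ℝ) (n : ℕ) (g : Metric I Θ) (ρ : Θ → ℝ) (v : VField I Θ) : ℝ :=
  n * priorMean g ρ (fun θ => fisher I μ f θ (v θ) (v θ)) +
    priorMean g ρ (fun θ => divρ g ρ v θ ^ 2)

/-- The Gill-Levit bound `⟨A⟩² / (n ⟨F⟩ + ⟨P⟩)`, with `A = v^a u_a`. -/
def bound [IsManifold I ∞ Θ] [MeasurableSpace Θ] {X : Type*} [MeasurableSpace X]
    (μ : Measure X) (f : Θ → X → ℝ) (n : ℕ) (g : Metric I Θ) (ρ : Θ → ℝ) (u : CField I Θ)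
    (v : VField I Θ) : ℝ :=
  priorMean g ρ (fun θ => u θ (v θ)) ^ 2 / denom μ f n g ρ v

/-- The vector fields for which the Gill-Levit bound is defined: `⟨A⟩`, `⟨F⟩`, `⟨P⟩` are finite
and the denominator is not zero. -/
structure InFamily [IsManifold I ∞ Θ] [MeasurableSpace Θ] {X : Type*} [MeasurableSpace X]
    (μ : Measure X) (f : Θ → X → ℝ) (n : ℕ) (g : Metric I Θ) (ρ : Θ → ℝ) (u : CField I Θ)
    (v : VField I Θ) : Prop where
  isField : IsField μ f g ρ v
  finite_A : PriorIntegrable g ρ (fun θ => u θ (v θ))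
  denom_ne : denom μ f n g ρ v ≠ 0

/-- A least favorable vector field: one that maximizes the Gill-Levit bound. -/
def IsLeastFavorable [IsManifold I ∞ Θ] [MeasurableSpace Θ] {X : Type*} [MeasurableSpace X]
    (μ : Measure X) (f : Θ → X → ℝ) (n : ℕ) (g : Metric I Θ) (ρ : Θ → ℝ) (u : CField I Θ)
    (v : VField I Θ) : Prop :=
  InFamily μ f n g ρ u v ∧
    ∀ v', InFamily μ f n g ρ u v' → bound μ f n g ρ u v' ≤ bound μ f n g ρ u v

/-- `w` is a value of `L⁻¹ u`: an admissible field with `L w = u` on the interior, for which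
`⟨u, w⟩_ρ` converges. -/
structure IsLInv [IsManifold I ∞ Θ] [MeasurableSpace Θ] {X : Type*} [MeasurableSpace X]
    (μ : Measure X) (f : Θ → X → ℝ) (n : ℕ) (g : Metric I Θ) (ρ : Θ → ℝ) (u : CField I Θ)
    (w : VField I Θ) : Prop where
  isField : IsField μ f g ρ w
  ldiff : LDiff g ρ w
  finite_A : PriorIntegrable g ρ (fun θ => u θ (w θ))
  eq : ∀ θ ∈ I.interior Θ, ∀ a : TangentSpace I θ, opL μ f n g ρ w θ a = u θ a

end GillLevit

end

noncomputable section

namespace GillLevit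

open scoped Pointwise

/-! ### The divergence theorem on convex open sets -/

/-! Put `form v w` $= n\langle v^aF_{ab}w^b\rangle + \langle \mathrm{div}_\rho v\,\mathrm{div}_\rho
w\rangle$, with $\mathrm{div}_\rho v=\tfrac1\rho\nabla_a(\rho v^a)$. It is symmetric and positive
semidefinite, and its diagonal is the denominator of the bound. Integrating the second term of `opL`
by parts gives $\langle v,Lw\rangle_\rho$ = `form v w` (`priorMean_opL`); symmetry and positivity of
$L$ follow at once.

If $Lw=u$, then $w$ represents the numerator: $\langle\mathsf A\rangle$ = `form v w` for every
competitor $v$. Hence $\mathsf B(v)$ = `form v w`² / `form v v`, and Cauchy-Schwarz (`form_sq_le`)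
bounds this by `form w w` $=\langle u,w\rangle_\rho$, the value at $v=w$. For a maximizer $v$ the
form vanishes on $w-cv$ for a suitable $c\ne0$. The form may be degenerate, so $cv=w$ need not
follow; but its density is continuous and nonnegative on the interior, so there $nF(w-cv)=0$ and
$\mathrm{div}_\rho(w-cv)=0$ (`formDensity_eq_zero`). These are the only data that $L$ sees, so
$L(cv)=u$ and $cv$ is itself a choice of $L^{-1}u$.

The analytic burden is the integration by parts `integral_dif_eq_neg_integral_divρ`, because the
fields are differentiable only on the interior and $\Theta$ may have corners and be noncompact. A
partition of unity reduces it to charts. There the range of the model with corners is convex, and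
`integral_euclDiv_eq_zero` applies: a cutoff built from the gauge has gradient $O(1/t)$ on a strip
of volume $O(t)$ where the field is uniformly small. The Piola identity `trace_fderiv_piola` makes
the divergence independent of the chart. The cutoffs in `VanishesOnBoundary` deal with infinity, and
a bounded truncation deals with unbounded test functions. -/

/-- The divergence of a vector field on Euclidean space. -/
def euclDiv {p : ℕ} (U : EuclideanSpace ℝ (Fin p) → EuclideanSpace ℝ (Fin p))
    (y : EuclideanSpace ℝ (Fin p)) : ℝ :=
  ∑ a, fderiv ℝ (fun y => U y a) y (EuclideanSpace.single a 1)

theorem lineDeriv_eq_zero_of_eventuallyEq_const {E : Type*} [NormedAddCommGroup E]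
    [NormedSpace ℝ E] {η : E → ℝ} {y : E} {c : ℝ} (h : η =ᶠ[𝓝 y] fun _ => c) (v : E) :
    lineDeriv ℝ η y v = 0 := by
  rw [h.lineDeriv_eq]
  simp [lineDeriv]

theorem exists_contDiff_cutoff {E : Type*} [NormedAddCommGroup E] [NormedSpace ℝ E]
    [FiniteDimensional ℝ E] {s t : Set E} (hs : IsClosed s) (ht : IsClosed t)
    (hst : Disjoint s t) :
    ∃ b : E → ℝ, ContDiff ℝ 1 b ∧ (∀ y ∈ s, b =ᶠ[𝓝 y] 0) ∧ ∀ y ∈ t, b =ᶠ[𝓝 y] 1 := by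
  obtain ⟨b, hb0, hb1, -⟩ :=
    exists_contMDiffMap_zero_one_nhds_of_isClosed (n := ⊤) 𝓘(ℝ, E) hs ht hst
  exact ⟨b, (b.contMDiff.contDiff).of_le (by simp), eventually_nhdsSet_iff_forall.1 hb0,
    eventually_nhdsSet_iff_forall.1 hb1⟩

/-- Integration by parts of a `C¹` function against a Lipschitz cutoff. -/
theorem integral_lipschitz_mul_fderiv {E : Type*} [NormedAddCommGroup E] [NormedSpace ℝ E]
    [FiniteDimensional ℝ E] [MeasurableSpace E] [BorelSpace E] (ν : Measure E) [ν.IsAddHaarMeasure]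
    {O : Set E} (hO : IsOpen O) {u : E → ℝ} (hs : HasCompactSupport u) (h1 : ContDiffOn ℝ 1 u O)
    {η : E → ℝ} {C : NNReal} (hη : LipschitzWith C η) (hηO : tsupport η ⊆ O) (v : E) :
    Integrable (fun y => η y * fderiv ℝ u y v) ν ∧
    ∫ y, η y * fderiv ℝ u y v ∂ν = -∫ y, lineDeriv ℝ η y v * u y ∂ν := by
  have hKc : IsCompact (tsupport η ∩ tsupport u) := hs.inter_left (isClosed_tsupport _)
  -- `u` is `C¹` only on `O`. Multiplying it by `b` gives a `C¹` function on the whole space that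
  -- agrees with `u` near the support of `η`, so integration by parts for two Lipschitz functions
  -- applies.
  obtain ⟨b, hbs, hb0, hb1⟩ := exists_contDiff_cutoff hO.isClosed_compl hKc.isClosed
    (disjoint_left.2 fun y hy hy' => hy (hηO hy'.1))
  set V : E → ℝ := fun y => b y * u y with hV
  have hVc : ContDiff ℝ 1 V := by
    rw [contDiff_iff_contDiffAt]
    intro y
    by_cases hy : y ∈ O
    · exact hbs.contDiffAt.mul (h1.contDiffAt (hO.mem_nhds hy))
    · have : V =ᶠ[𝓝 y] fun _ => 0 := by
        filter_upwards [hb0 y hy] with z hz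
        simp [hV, hz]
      exact contDiffAt_const.congr_of_eventuallyEq this
  have hVs : HasCompactSupport V := hs.mul_left
  have hVU : ∀ y ∈ tsupport η, V =ᶠ[𝓝 y] u := by
    intro y hy
    by_cases hyU : y ∈ tsupport u
    · filter_upwards [hb1 y ⟨hy, hyU⟩] with z hz
      simp [hV, hz]
    · filter_upwards [notMem_tsupport_iff_eventuallyEq.1 hyU] with z hz
      simp [hV, hz]
  have e1 : ∀ y, η y * fderiv ℝ u y v = fderiv ℝ V y v * η y := by
    intro y
    by_cases hy : y ∈ tsupport η
    · rw [(hVU y hy).fderiv_eq, mul_comm]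
    · simp [image_eq_zero_of_notMem_tsupport hy]
  have e2 : ∀ y, lineDeriv ℝ η y v * u y = lineDeriv ℝ η y v * V y := by
    intro y
    by_cases hy : y ∈ tsupport η
    · rw [(hVU y hy).eq_of_nhds]
    · rw [lineDeriv_eq_zero_of_eventuallyEq_const (notMem_tsupport_iff_eventuallyEq.1 hy)]
      simp
  simp_rw [e1, e2]
  obtain ⟨D, hD⟩ := ContDiff.lipschitzWith_of_hasCompactSupport hVs hVc one_ne_zero
  constructor
  · refine Continuous.integrable_of_hasCompactSupport ?_ ?_
    · exact ((hVc.continuous_fderiv one_ne_zero).clm_apply continuous_const).mul hη.continuous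
    · exact (hVs.fderiv_apply ℝ v).mul_right
  · rw [hη.integral_lineDeriv_mul_eq (μ := ν) hD hVs, ← integral_neg]
    refine integral_congr_ae (Eventually.of_forall fun y => ?_)
    simp [(hVc.differentiable one_ne_zero y).lineDeriv_eq_fderiv]

/-- The dilate `(1 - t) • A` of `A = O ∩ ball 0 R` stays in `A` and misses the strip, since the
gauge is homogeneous and below 1 on `O`. It has volume `(1 - t) ^ p` times that of `A`, and
Bernoulli's inequality bounds what is left. -/
theorem volume_gauge_strip_le {p : ℕ} {O : Set (EuclideanSpace ℝ (Fin p))} (hO : IsOpen O)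
    (hc : Convex ℝ O) (h0 : (0 : EuclideanSpace ℝ (Fin p)) ∈ O) (R : ℝ) {t : ℝ} (ht0 : 0 ≤ t)
    (ht1 : t < 1) :
    volume.real ({y | 1 - t ≤ gauge O y} ∩ (O ∩ Metric.ball 0 R)) ≤
      p * t * volume.real (O ∩ Metric.ball 0 R) := by
  set A := O ∩ Metric.ball (0 : EuclideanSpace ℝ (Fin p)) R with hA
  have hAf : volume A ≠ ⊤ :=
    (lt_of_le_of_lt (measure_mono inter_subset_right) measure_ball_lt_top).ne
  have hAm : MeasurableSet A := hO.measurableSet.inter measurableSet_ball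
  have hg : Continuous (gauge O) := continuous_gauge hc (hO.mem_nhds h0)
  have hlt : ∀ y ∈ O, gauge O y < 1 := fun y hy => gauge_lt_one_of_mem_of_isOpen hO hy
  have hsub : (1 - t) • A ⊆ A \ ({y | 1 - t ≤ gauge O y} ∩ A) := by
    rintro _ ⟨y, hy, rfl⟩
    have hy1 : (1 - t) • y ∈ A := by
      refine ⟨hc.smul_mem_of_zero_mem h0 hy.1 ⟨by linarith, by linarith⟩, ?_⟩
      have := hy.2
      simp only [mem_ball_zero_iff, norm_smul, Real.norm_eq_abs] at this ⊢
      rw [abs_of_nonneg (by linarith)]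
      nlinarith [norm_nonneg y]
    refine ⟨hy1, fun h => ?_⟩
    have h2 := h.1
    simp only [mem_ofPred_eq] at h2
    rw [gauge_smul_of_nonneg (by linarith : (0 : ℝ) ≤ 1 - t), smul_eq_mul] at h2
    nlinarith [hlt y hy.1]
  have hSm : MeasurableSet ({y | 1 - t ≤ gauge O y} ∩ A) :=
    (isClosed_le continuous_const hg).measurableSet.inter hAm
  have h1 := measureReal_mono (μ := volume) hsub (ne_top_of_le_ne_top hAf (measure_mono sdiff_subset))
  rw [measureReal_sdiff inter_subset_right hSm] at h1
  have h2 : volume.real ((1 - t) • A) = (1 - t) ^ p * volume.real A := by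
    rw [measureReal_def, Measure.addHaar_smul_of_nonneg _ (by linarith)]
    simp [measureReal_def, ENNReal.toReal_ofReal, pow_nonneg (sub_nonneg.2 ht1.le)]
  have h3 : 1 + (p : ℝ) * (-t) ≤ (1 + (-t)) ^ p := one_add_mul_le_pow (by linarith) p
  have h4 : 0 ≤ volume.real A := measureReal_nonneg
  have h5 : (1 + (-t)) ^ p = (1 - t) ^ p := by ring_nf
  nlinarith

/-- A Lipschitz cutoff of the convex set `O`, in terms of its gauge. -/
def gaugeCutoff {E : Type*} [AddCommGroup E] [Module ℝ E] (O : Set E) (t : ℝ) (y : E) : ℝ :=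
  max 0 (min 1 ((1 - gauge O y) / t - 1))

theorem gaugeCutoff_eq_one {E : Type*} [AddCommGroup E] [Module ℝ E] {O : Set E} {t : ℝ}
    (ht : 0 < t) {y : E} (h : gauge O y ≤ 1 - 2 * t) : gaugeCutoff O t y = 1 := by
  have : 2 ≤ (1 - gauge O y) / t := by rw [le_div_iff₀ ht]; linarith
  rw [gaugeCutoff, min_eq_left (by linarith), max_eq_right zero_le_one]

theorem gaugeCutoff_eq_zero {E : Type*} [AddCommGroup E] [Module ℝ E] {O : Set E} {t : ℝ}
    (ht : 0 < t) {y : E} (h : 1 - t ≤ gauge O y) : gaugeCutoff O t y = 0 := by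
  have : (1 - gauge O y) / t ≤ 1 := by rw [div_le_iff₀ ht]; linarith
  rw [gaugeCutoff, max_eq_left]
  exact (min_le_right _ _).trans (by linarith)

theorem abs_gaugeCutoff_le {E : Type*} [AddCommGroup E] [Module ℝ E] (O : Set E) (t : ℝ) (y : E) :
    |gaugeCutoff O t y| ≤ 1 := by
  rw [gaugeCutoff, abs_of_nonneg (le_max_left _ _)]
  exact max_le zero_le_one (min_le_left _ _)

theorem lipschitzWith_gaugeCutoff {E : Type*} [NormedAddCommGroup E] [NormedSpace ℝ E]
    {O : Set E} {K : NNReal} (hK : LipschitzWith K (gauge O)) {t : NNReal} :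
    LipschitzWith (K / t) (gaugeCutoff O t) := by
  refine LipschitzWith.const_max (LipschitzWith.const_min ?_ 1) 0
  refine LipschitzWith.of_dist_le_mul fun x y => ?_
  have h := hK.dist_le_mul x y
  rw [Real.dist_eq] at h ⊢
  have e : (1 - gauge O x) / t - 1 - ((1 - gauge O y) / t - 1) =
      -((gauge O x - gauge O y) / t) := by ring
  rw [e, abs_neg, abs_div, NNReal.abs_eq, NNReal.coe_div, div_mul_eq_mul_div]
  gcongr

/-- Against the gauge cutoff, integration by parts leaves an error supported in a strip along the
boundary. The gradient is `O(1/t)`, the volume of the strip `O(t)`, and `U` tends to zero uniformly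
as the strip shrinks, so the error vanishes in the limit. No derivative of `U` at the boundary is
needed. -/
theorem integral_euclDiv_eq_zero_of_zero_mem {p : ℕ} {O : Set (EuclideanSpace ℝ (Fin p))}
    (hO : IsOpen O) (hc : Convex ℝ O) (h0 : (0 : EuclideanSpace ℝ (Fin p)) ∈ O)
    {U : EuclideanSpace ℝ (Fin p) → EuclideanSpace ℝ (Fin p)}
    (hU : Continuous U) (hs : HasCompactSupport U) (hz : ∀ y ∉ O, U y = 0)
    (h1 : ContDiffOn ℝ 1 U O) (hint : IntegrableOn (euclDiv U) O) :
    ∫ y in O, euclDiv U y = 0 := by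
  obtain ⟨K, hK⟩ := hc.lipschitz_gauge (hO.mem_nhds h0)
  have hg : Continuous (gauge O) := hK.continuous
  have hlt : ∀ y, y ∈ O ↔ gauge O y < 1 := fun y =>
    (Set.ext_iff.1 (setOfPred_gauge_lt_one_eq_self_of_isOpen hc h0 hO) y).symm
  obtain ⟨R, hR⟩ := hs.isBounded.subset_ball 0
  set A := O ∩ Metric.ball (0 : EuclideanSpace ℝ (Fin p)) R with hA
  have hzA : ∀ y ∉ A, U y = 0 := fun y hy => by
    by_contra h
    exact hy ⟨by_contra fun h' => h (hz y h'), hR (subset_tsupport _ h)⟩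
  have hAf : volume A ≠ ⊤ :=
    (lt_of_le_of_lt (measure_mono inter_subset_right) measure_ball_lt_top).ne
  -- The set where `ε ≤ ‖U y‖` is compact and contained in `O`, so the gauge attains on it a maximum
  -- below 1; that maximum is `m`.
  have hsmall : ∀ ε > 0, ∃ m < 1, ∀ y, m < gauge O y → ‖U y‖ ≤ ε := by
    intro ε hε
    have hcpt : IsCompact {y | ε ≤ ‖U y‖} := by
      refine hs.of_isClosed_subset (isClosed_le continuous_const hU.norm) fun y hy => ?_
      refine subset_tsupport _ fun h => ?_
      have hy' : ε ≤ ‖U y‖ := hy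
      rw [h, norm_zero] at hy'
      linarith
    rcases ({y | ε ≤ ‖U y‖} : Set _).eq_empty_or_nonempty with he | hne
    · refine ⟨0, one_pos, fun y _ => le_of_not_ge fun h => ?_⟩
      exact (he ▸ (show y ∈ {y | ε ≤ ‖U y‖} from h) : y ∈ (∅ : Set _))
    · obtain ⟨y₀, hy₀, hmax⟩ := hcpt.exists_isMaxOn hne hg.continuousOn
      refine ⟨gauge O y₀, (hlt y₀).1 (by_contra fun h => ?_), fun y hy => le_of_not_ge fun h => ?_⟩
      · have hy' : ε ≤ ‖U y₀‖ := hy₀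
        rw [hz _ h, norm_zero] at hy'
        linarith
      · exact absurd (hmax h) (not_le.2 hy)
  have hUa : ∀ a, ContDiffOn ℝ 1 (fun y => U y a) O := fun a =>
    (EuclideanSpace.proj (𝕜 := ℝ) a).contDiff.comp_contDiffOn h1
  have hUas : ∀ a, HasCompactSupport (fun y => U y a) := fun a =>
    hs.comp_left (g := fun z : EuclideanSpace ℝ (Fin p) => z a) (by simp)
  have hts : ∀ t : NNReal, 0 < t → tsupport (gaugeCutoff O t) ⊆ O := by
    intro t ht
    have h2 : tsupport (gaugeCutoff O t) ⊆ {y | gauge O y ≤ 1 - t} := by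
      refine closure_minimal (fun y hy => ?_) (isClosed_le hg continuous_const)
      by_contra h
      exact hy (gaugeCutoff_eq_zero (by exact_mod_cast ht) (not_le.1 h).le)
    intro y hy
    have := h2 hy
    have ht' : (0 : ℝ) < t := by exact_mod_cast ht
    rw [hlt]
    simp only [mem_ofPred_eq] at this
    linarith
  -- The Lipschitz constant `K / t` cancels against the strip volume `p * (2 * t) * volume.real A`;
  -- the outer factor `p` counts the coordinates. The bound no longer contains `t`.
  have hbound : ∀ ε > 0, ∃ m < (1 : ℝ), ∀ t : NNReal, 0 < t → m < 1 - 2 * (t : ℝ) → 0 < 1 - 2 * (t : ℝ) →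
      |∫ y in O, gaugeCutoff O t y * euclDiv U y| ≤ ε * (p * (2 * K * p * volume.real A)) := by
    intro ε hε
    obtain ⟨m, hm, hmU⟩ := hsmall ε hε
    refine ⟨m, hm, fun t ht hmt ht2 => ?_⟩
    have ht' : (0 : ℝ) < t := by exact_mod_cast ht
    set η := gaugeCutoff O t with hη
    have hηL : LipschitzWith (K / t) η := lipschitzWith_gaugeCutoff hK
    have key := fun a => integral_lipschitz_mul_fderiv volume hO (hUas a) (hUa a) hηL (hts t ht)
      (EuclideanSpace.single a 1)
    have e1 : ∫ y in O, η y * euclDiv U y = ∫ y, η y * euclDiv U y := by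
      refine setIntegral_eq_integral_of_forall_compl_eq_zero fun y hy => ?_
      rw [hη, image_eq_zero_of_notMem_tsupport fun h => hy (hts t ht h), zero_mul]
    have e2 : ∫ y, η y * euclDiv U y =
        ∑ a, -∫ y, lineDeriv ℝ η y (EuclideanSpace.single a 1) * U y a := by
      simp_rw [euclDiv, Finset.mul_sum]
      rw [integral_finsetSum _ fun a _ => (key a).1]
      exact Finset.sum_congr rfl fun a _ => (key a).2
    rw [e1, e2]
    set S := {y | 1 - 2 * (t : ℝ) ≤ gauge O y} ∩ A with hS
    have hSm : MeasurableSet S := (isClosed_le continuous_const hg).measurableSet.inter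
      (hO.measurableSet.inter measurableSet_ball)
    have hSf : volume S < ⊤ := lt_of_le_of_lt (measure_mono inter_subset_right) hAf.lt_top
    have hvol : volume.real S ≤ p * (2 * t) * volume.real A :=
      volume_gauge_strip_le hO hc h0 R (by positivity) (by linarith)
    have hterm : ∀ a : Fin p, |(-∫ y, lineDeriv ℝ η y (EuclideanSpace.single a 1) * U y a)| ≤
        ε * (2 * K * p * volume.real A) := by
      intro a
      -- Only the strip contributes: where the gauge is below `1 - 2 * t` the cutoff is locally
      -- constant, and off `A` the field vanishes.
      rw [abs_neg, ← setIntegral_eq_integral_of_forall_compl_eq_zero (s := S)]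
      · have h3 := norm_setIntegral_le_of_norm_le_const (μ := volume) (s := S)
          (f := fun y => lineDeriv ℝ η y (EuclideanSpace.single a 1) * U y a)
          (C := K / t * ε) hSf (fun y hy => ?_)
        · rw [Real.norm_eq_abs] at h3
          refine h3.trans ?_
          calc K / t * ε * volume.real S ≤ K / t * ε * (p * (2 * t) * volume.real A) := by gcongr
            _ = ε * (2 * K * p * volume.real A) := by field_simp
        · rw [norm_mul]
          have h4 := norm_lineDeriv_le_of_lipschitz ℝ (x₀ := y) (v := EuclideanSpace.single a 1) hηL
          have h5 : ‖U y a‖ ≤ ε := (PiLp.norm_apply_le (U y) a).trans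
            (hmU y (lt_of_lt_of_le hmt hy.1))
          simp only [PiLp.norm_single, norm_one, mul_one, NNReal.coe_div] at h4
          gcongr
      · intro y hy
        by_cases hyA : y ∈ A
        · have h6 : gauge O y < 1 - 2 * t := not_le.1 fun h => hy ⟨h, hyA⟩
          rw [lineDeriv_eq_zero_of_eventuallyEq_const (c := 1), zero_mul]
          filter_upwards [(isOpen_lt hg continuous_const).mem_nhds h6] with z hz
          exact gaugeCutoff_eq_one ht' (le_of_lt hz)
        · simp [hzA y hyA]
    refine (Finset.abs_sum_le_sum_abs _ _).trans ((Finset.sum_le_sum fun a _ => hterm a).trans ?_)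
    simp only [Finset.sum_const, Finset.card_univ, Fintype.card_fin, nsmul_eq_mul]
    exact le_of_eq (by ring)
  set τ : ℕ → NNReal := fun k => 1 / ((k : NNReal) + 3) with hτ
  have hτpos : ∀ k, 0 < τ k := fun k => by positivity
  have hτ0 : Tendsto (fun k => (τ k : ℝ)) atTop (𝓝 0) := by
    have := (tendsto_const_div_atTop_nhds_zero_nat (1 : ℝ)).comp (tendsto_add_atTop_nat 3)
    refine this.congr fun k => ?_
    simp [hτ]
  have hτ1 : Tendsto (fun k => 1 - 2 * (τ k : ℝ)) atTop (𝓝 1) := by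
    simpa using (hτ0.const_mul 2).const_sub 1
  have hlim : Tendsto (fun k => ∫ y in O, gaugeCutoff O (τ k) y * euclDiv U y) atTop
      (𝓝 (∫ y in O, euclDiv U y)) := by
    refine tendsto_integral_of_dominated_convergence (fun y => ‖euclDiv U y‖) (fun k => ?_)
      hint.norm (fun k => ?_) ?_
    · exact (lipschitzWith_gaugeCutoff hK).continuous.aestronglyMeasurable.mul
        hint.aestronglyMeasurable
    · refine Eventually.of_forall fun y => ?_
      rw [norm_mul]
      exact mul_le_of_le_one_left (norm_nonneg _) (abs_gaugeCutoff_le _ _ _)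
    · refine (ae_restrict_iff' hO.measurableSet).2 (Eventually.of_forall fun y hy => ?_)
      refine tendsto_const_nhds.congr' ?_
      filter_upwards [hτ1.eventually (lt_mem_nhds ((hlt y).1 hy))] with k hk
      rw [gaugeCutoff_eq_one (by exact_mod_cast hτpos k) hk.le, one_mul]
  refine tendsto_nhds_unique hlim ?_
  rw [Metric.tendsto_nhds]
  intro δ hδ
  set B : ℝ := p * (2 * K * p * volume.real A) with hB
  have hB0 : 0 ≤ B := by positivity
  -- `B` may be zero; dividing by `B + 1` avoids that case and makes the final inequality strict.
  obtain ⟨m, hm, hmb⟩ := hbound (δ / (B + 1)) (by positivity)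
  filter_upwards [hτ1.eventually (lt_mem_nhds hm), hτ1.eventually (lt_mem_nhds one_pos)]
    with k hk1 hk2
  rw [dist_zero_right, Real.norm_eq_abs]
  refine lt_of_le_of_lt (hmb (τ k) (hτpos k) hk1 hk2) ?_
  rw [div_mul_eq_mul_div, div_lt_iff₀ (by positivity)]
  nlinarith

/-- The divergence theorem for a field that vanishes on the boundary of a convex set, where it
need not be differentiable. -/
theorem integral_euclDiv_eq_zero {p : ℕ} {O : Set (EuclideanSpace ℝ (Fin p))}
    (hO : IsOpen O) (hc : Convex ℝ O)
    {U : EuclideanSpace ℝ (Fin p) → EuclideanSpace ℝ (Fin p)}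
    (hU : Continuous U) (hs : HasCompactSupport U) (hz : ∀ y ∉ O, U y = 0)
    (h1 : ContDiffOn ℝ 1 U O) (hint : IntegrableOn (euclDiv U) O) :
    ∫ y in O, euclDiv U y = 0 := by
  rcases O.eq_empty_or_nonempty with rfl | ⟨y₀, hy₀⟩
  · simp
  have hcont : Continuous fun y : EuclideanSpace ℝ (Fin p) => y + y₀ := by fun_prop
  -- The gauge requires the origin inside the set, so a point of `O` is translated there.
  set W := fun y => U (y + y₀) with hW
  have hdiv : ∀ y, euclDiv W y = euclDiv U (y + y₀) := by
    intro y
    simp only [euclDiv, hW]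
    exact Finset.sum_congr rfl fun a _ => by
      rw [fderiv_comp_add_right (f := fun y => U y a)]
  have hmp : MeasurePreserving (fun y : EuclideanSpace ℝ (Fin p) => y + y₀) volume volume :=
    measurePreserving_add_right _ _
  have hme : MeasurableEmbedding (fun y : EuclideanSpace ℝ (Fin p) => y + y₀) :=
    measurableEmbedding_addRight _
  have h := integral_euclDiv_eq_zero_of_zero_mem (O := (fun y => y + y₀) ⁻¹' O) (U := W)
    (hO.preimage hcont) (hc.translate_preimage_left y₀) (by simpa using hy₀) (hU.comp hcont)
    (hs.comp_homeomorph (Homeomorph.addRight y₀)) (fun y hy => hz _ hy)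
    (h1.comp (by fun_prop) fun y hy => hy)
    (by
      rw [funext hdiv]
      exact (hmp.integrableOn_comp_preimage hme).2 hint)
  rw [← h, funext hdiv, hmp.setIntegral_preimage_emb hme]

/-! ### The Piola identity -/

section Piola

variable {E : Type*} [NormedAddCommGroup E] [NormedSpace ℝ E] [FiniteDimensional ℝ E]

theorem contDiff_det : ContDiff ℝ ∞ (fun A : E →L[ℝ] E => A.det) := by
  classical
  set b := Module.finBasis ℝ E
  have h : ∀ A : E →L[ℝ] E, A.det = (LinearMap.toMatrix b b (A : E →ₗ[ℝ] E)).det := fun A =>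
    (LinearMap.det_toMatrix b _).symm
  simp_rw [h, Matrix.det_apply]
  refine ContDiff.sum fun σ _ => ContDiff.const_smul _ (contDiff_prod fun i _ => ?_)
  set ℓ : (E →L[ℝ] E) →ₗ[ℝ] ℝ :=
    { toFun := fun A => LinearMap.toMatrix b b (A : E →ₗ[ℝ] E) (σ i) i
      map_add' := fun A B => by simp
      map_smul' := fun c A => by simp }
  exact ℓ.toContinuousLinearMap.contDiff

theorem hasDerivAt_det_one_add_smul (M : E →L[ℝ] E) :
    HasDerivAt (fun t : ℝ => (1 + t • M : E →L[ℝ] E).det)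
      (LinearMap.trace ℝ E (M : E →ₗ[ℝ] E)) 0 := by
  classical
  set b := Module.finBasis ℝ E
  set B := LinearMap.toMatrix b b (M : E →ₗ[ℝ] E) with hB
  have h : ∀ t : ℝ, (1 + t • M : E →L[ℝ] E).det = (1 + t • B).det := fun t => by
    rw [ContinuousLinearMap.det, ← LinearMap.det_toMatrix b]
    congr 1
    rw [hB]
    have : ((1 + t • M : E →L[ℝ] E) : E →ₗ[ℝ] E) = LinearMap.id + t • (M : E →ₗ[ℝ] E) := rfl
    rw [this, map_add, map_smul, LinearMap.toMatrix_id]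
  obtain ⟨q, hq⟩ : ∃ q : Polynomial ℝ, ∀ t : ℝ,
      (1 + t • M : E →L[ℝ] E).det = 1 + B.trace * t + q.eval t * t ^ 2 :=
    ⟨_, fun t => (h t).trans (Matrix.det_one_add_smul t B)⟩
  simp_rw [hq]
  rw [LinearMap.trace_eq_matrix_trace ℝ b]
  have h1 : HasDerivAt (fun t : ℝ => 1 + B.trace * t) (B.trace) 0 := by
    simpa using ((hasDerivAt_id (0 : ℝ)).const_mul B.trace).const_add 1
  have h2 : HasDerivAt (fun t : ℝ => q.eval t * t ^ 2) 0 0 := by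
    have := (q.hasDerivAt 0).mul (hasDerivAt_pow 2 (0 : ℝ))
    simpa [Pi.mul_def] using this
  have h3 := h1.add h2
  rw [add_zero] at h3
  exact h3

/-- Jacobi's formula at an invertible map, from the factorization $\det(A+tB)=\det
A\,\det(1+tA^{-1}B)$. -/
theorem fderiv_det (A : E ≃L[ℝ] E) (B : E →L[ℝ] E) :
    fderiv ℝ (fun A : E →L[ℝ] E => A.det) A B =
      (A : E →L[ℝ] E).det *
        LinearMap.trace ℝ E (((A.symm : E →L[ℝ] E).comp B : E →L[ℝ] E) : E →ₗ[ℝ] E) := by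
  have h1 : HasFDerivAt (fun A : E →L[ℝ] E => A.det) _ (A : E →L[ℝ] E) :=
    ((contDiff_det (E := E)).differentiable (by simp) _).hasFDerivAt
  have h2 : HasDerivAt (fun t : ℝ => (A : E →L[ℝ] E) + t • B) B 0 := by
    simpa using ((hasDerivAt_id (0 : ℝ)).smul_const B).const_add (A : E →L[ℝ] E)
  have h3 := HasFDerivAt.comp_hasDerivAt_of_eq (0 : ℝ) h1 h2 (by simp)
  have h4 := (hasDerivAt_det_one_add_smul ((A.symm : E →L[ℝ] E).comp B)).const_mul
    (A : E →L[ℝ] E).det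
  refine h3.unique (h4.congr_of_eventuallyEq (Eventually.of_forall fun t => ?_))
  simp only [Function.comp_apply]
  rw [ContinuousLinearMap.det, ContinuousLinearMap.det, ContinuousLinearMap.det, ← LinearMap.det_comp]
  congr 1
  ext z
  simp

/-- Differentiate the relation between `N` and `R`, apply the inverse of $A=D\tau$ and take the
trace. The second derivative of `τ` enters twice: through $D^2\tau(\cdot,N)$ and, by Jacobi's
formula, through the derivative of the determinant. As $D^2\tau$ is symmetric and $N=|\det
A|\,A^{-1}R$, the two contributions cancel. What remains is $|\det
A|\,\mathrm{tr}(A^{-1}\,DR\,A)=|\det A|\,\mathrm{tr}\,DR$. -/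
theorem trace_fderiv_piola {τ N R : E → E} {y : E} (hτ : ContDiffAt ℝ 2 τ y)
    (hN : DifferentiableAt ℝ N y) (hR : DifferentiableAt ℝ R (τ y))
    (h : ∀ᶠ z in 𝓝 y, fderiv ℝ τ z (N z) = |(fderiv ℝ τ z).det| • R (τ z))
    (hd : (fderiv ℝ τ y).det ≠ 0) :
    LinearMap.trace ℝ E (fderiv ℝ N y : E →ₗ[ℝ] E) =
      |(fderiv ℝ τ y).det| * LinearMap.trace ℝ E (fderiv ℝ R (τ y) : E →ₗ[ℝ] E) := by
  obtain ⟨A, hA⟩ : ∃ A : E ≃L[ℝ] E, (A : E →L[ℝ] E) = fderiv ℝ τ y :=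
    ⟨_, ContinuousLinearMap.coe_toContinuousLinearEquivOfDetNeZero _ hd⟩
  set d := (fderiv ℝ τ y).det with hdef
  set D2 := fderiv ℝ (fderiv ℝ τ) y with hD2
  have hsymm : ∀ v w, D2 v w = D2 w v := hτ.isSymmSndFDerivAt (by simp)
  have hDτ : HasFDerivAt (fderiv ℝ τ) D2 y :=
    ((hτ.fderiv_right (m := 1) (by norm_num)).differentiableAt one_ne_zero).hasFDerivAt
  have hτd : HasFDerivAt τ (fderiv ℝ τ y) y := (hτ.differentiableAt two_ne_zero).hasFDerivAt
  have hdet : HasFDerivAt (fun z => (fderiv ℝ τ z).det) _ y :=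
    (((contDiff_det (E := E)).differentiable (by simp) _).hasFDerivAt).comp y hDτ
  -- The determinant keeps its sign near `y`, so its absolute value is locally `c` times it, hence
  -- differentiable.
  set c : ℝ := ((SignType.sign d : SignType) : ℝ) with hc
  have habs : ∀ᶠ z in 𝓝 y, |(fderiv ℝ τ z).det| = c * (fderiv ℝ τ z).det := by
    have hcont := hdet.continuousAt
    rcases lt_or_gt_of_ne hd with hlt | hgt
    · filter_upwards [hcont.eventually (gt_mem_nhds hlt)] with z hz
      rw [abs_of_neg hz, hc, sign_neg hlt]
      simp
    · filter_upwards [hcont.eventually (lt_mem_nhds hgt)] with z hz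
      rw [abs_of_pos hz, hc, sign_pos hgt]
      simp
  have h1 : HasFDerivAt (fun z => fderiv ℝ τ z (N z)) _ y := hDτ.clm_apply hN.hasFDerivAt
  have h2 : HasFDerivAt (fun z => (c * (fderiv ℝ τ z).det) • R (τ z)) _ y :=
    (hdet.const_mul c).smul (hR.hasFDerivAt.comp y hτd)
  have h3 := h1.unique (h2.congr_of_eventuallyEq (by
    filter_upwards [h, habs] with z hz hz'
    rw [hz, hz']))
  have hcd : c * d = |d| := (habs.self_of_nhds).symm
  have hNy : N y = |d| • A.symm (R (τ y)) := by
    have h0 : (A : E →L[ℝ] E) (N y) = |d| • R (τ y) := by rw [hA]; exact h.self_of_nhds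
    rw [← map_smul, ← h0]
    simp
  set ℓ : E →ₗ[ℝ] ℝ := ((c • (fderiv ℝ (fun A : E →L[ℝ] E => A.det) (fderiv ℝ τ y)).comp D2 :
    E →L[ℝ] ℝ) : E →ₗ[ℝ] ℝ) with hℓ
  have hℓv : ∀ v, ℓ v = |d| *
      LinearMap.trace ℝ E (((A.symm : E →L[ℝ] E).comp (D2 v) : E →L[ℝ] E) : E →ₗ[ℝ] E) := by
    intro v
    have := fderiv_det A (D2 v)
    rw [hA] at this
    simp only [hℓ, ContinuousLinearMap.coe_coe, smul_apply,
      ContinuousLinearMap.comp_apply, this, smul_eq_mul, ← hcd]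
    ring
  -- The differentiated relation solved for the derivative of `N`; `ℓ` is the differential of $|\det
  -- D\tau|$, and the symmetry of `D2` has moved `N y` into its first slot.
  have h4 : (fderiv ℝ N y : E →ₗ[ℝ] E) = ℓ.smulRight (A.symm (R (τ y))) +
      |d| • ((A.symm : E →ₗ[ℝ] E) ∘ₗ (fderiv ℝ R (τ y) : E →ₗ[ℝ] E) ∘ₗ (A : E →ₗ[ℝ] E)) -
      (((A.symm : E →L[ℝ] E).comp (D2 (N y)) : E →L[ℝ] E) : E →ₗ[ℝ] E) := by
    ext v
    have h5 := congrArg (fun T : E →L[ℝ] E => A.symm (T v)) h3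
    have h6 : fderiv ℝ τ y (fderiv ℝ N y v) = A (fderiv ℝ N y v) := by rw [← hA]; rfl
    have h7 : fderiv ℝ τ y v = A v := by rw [← hA]; rfl
    simp only [add_apply, ContinuousLinearMap.comp_apply,
      ContinuousLinearMap.flip_apply, smul_apply,
      ContinuousLinearMap.smulRight_apply, map_add, map_smul, h6, h7,
      ContinuousLinearEquiv.symm_apply_apply] at h5
    simp only [LinearMap.sub_apply, LinearMap.add_apply, LinearMap.smul_apply,
      LinearMap.smulRight_apply, LinearMap.comp_apply, ContinuousLinearMap.coe_coe,
      ContinuousLinearMap.comp_apply, hℓ, smul_apply, hsymm (N y) v]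
    rw [eq_sub_iff_add_eq, ← hcd]
    simpa [add_comm] using h5
  rw [h4, map_sub, map_add, map_smul, LinearMap.trace_smulRight, hℓv]
  have h8 : LinearMap.trace ℝ E ((A.symm : E →ₗ[ℝ] E) ∘ₗ (fderiv ℝ R (τ y) : E →ₗ[ℝ] E) ∘ₗ
      (A : E →ₗ[ℝ] E)) = LinearMap.trace ℝ E (fderiv ℝ R (τ y) : E →ₗ[ℝ] E) := by
    rw [LinearMap.trace_comp_comm', LinearMap.comp_assoc]
    congr 1
    ext v
    simp
  rw [h8, hNy]
  have h9 : (((A.symm : E →L[ℝ] E).comp (D2 (|d| • A.symm (R (τ y)))) : E →L[ℝ] E) : E →ₗ[ℝ] E) =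
      |d| • (((A.symm : E →L[ℝ] E).comp (D2 (A.symm (R (τ y)))) : E →L[ℝ] E) : E →ₗ[ℝ] E) := by
    ext v
    simp
  rw [h9, map_smul, smul_eq_mul, smul_eq_mul]
  ring

end Piola

theorem fderiv_component {p : ℕ} {U : EuclideanSpace ℝ (Fin p) → EuclideanSpace ℝ (Fin p)}
    {y : EuclideanSpace ℝ (Fin p)} (h : DifferentiableAt ℝ U y) (a : Fin p)
    (z : EuclideanSpace ℝ (Fin p)) :
    fderiv ℝ (fun y => U y a) y z = fderiv ℝ U y z a := by
  have h2 : HasFDerivAt (fun y => U y a) _ y :=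
    ((EuclideanSpace.proj (𝕜 := ℝ) a).hasFDerivAt (x := U y)).comp y h.hasFDerivAt
  rw [h2.fderiv]
  rfl

/-- Connects the coordinate formula with the basis-free trace in which the Piola identity and the
product rule are proved. -/
theorem euclDiv_eq_trace {p : ℕ} {U : EuclideanSpace ℝ (Fin p) → EuclideanSpace ℝ (Fin p)}
    {y : EuclideanSpace ℝ (Fin p)} (h : DifferentiableAt ℝ U y) :
    euclDiv U y = LinearMap.trace ℝ _
      (fderiv ℝ U y : EuclideanSpace ℝ (Fin p) →ₗ[ℝ] EuclideanSpace ℝ (Fin p)) := by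
  rw [LinearMap.trace_eq_sum_inner _ (EuclideanSpace.basisFun (Fin p) ℝ)]
  refine Finset.sum_congr rfl fun a _ => ?_
  rw [fderiv_component h]
  simp [EuclideanSpace.inner_single_left]

/-! ### Calculus in charts -/

section Charts

variable {p : ℕ} {H : Type*} [TopologicalSpace H]
  {I : ModelWithCorners ℝ (EuclideanSpace ℝ (Fin p)) H}
  {Θ : Type*} [TopologicalSpace Θ] [ChartedSpace H Θ]

theorem isOpen_interior_manifold [IsManifold I ∞ Θ] : IsOpen (I.interior Θ) :=
  I.isOpen_interior (n := ∞) (by simp)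

theorem interior_mem_nhds [IsManifold I ∞ Θ] {θ : Θ} (h : θ ∈ I.interior Θ) :
    I.interior Θ ∈ 𝓝 θ :=
  isOpen_interior_manifold.mem_nhds h

theorem extChartAt_mem_interior_iff [IsManifold I ∞ Θ] {x θ : Θ}
    (h : θ ∈ (extChartAt I x).source) :
    extChartAt I x θ ∈ interior (extChartAt I x).target ↔ θ ∈ I.interior Θ :=
  (I.isInteriorPoint_iff_of_mem_atlas (n := ∞) (by simp) (chart_mem_atlas H x)
    (by rwa [extChartAt_source] at h)).symm

theorem extChartAt_symm_mem_interior_iff [IsManifold I ∞ Θ] {x : Θ}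
    {y : EuclideanSpace ℝ (Fin p)} (hy : y ∈ (extChartAt I x).target) :
    (extChartAt I x).symm y ∈ I.interior Θ ↔ y ∈ interior (extChartAt I x).target := by
  rw [← extChartAt_mem_interior_iff ((extChartAt I x).map_target hy),
    (extChartAt I x).right_inv hy]

theorem range_mem_nhds {x : Θ} {y : EuclideanSpace ℝ (Fin p)}
    (hy : y ∈ interior (extChartAt I x).target) : range I ∈ 𝓝 y :=
  mem_of_superset (mem_interior_iff_mem_nhds.1 hy) (extChartAt_target_subset_range x)

theorem continuousAt_extChartAt_symm_interior {x : Θ} {y : EuclideanSpace ℝ (Fin p)}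
    (hy : y ∈ interior (extChartAt I x).target) : ContinuousAt (extChartAt I x).symm y :=
  (continuousOn_extChartAt_symm x).continuousAt (mem_interior_iff_mem_nhds.1 hy)

variable (I) in
/-- The isomorphism from coordinate vectors to tangent vectors given by the chart at `x`. -/
def chartFrame [IsManifold I ∞ Θ] (x θ : Θ) : EuclideanSpace ℝ (Fin p) →L[ℝ] TangentSpace I θ :=
  (trivializationAt (EuclideanSpace ℝ (Fin p)) (TangentSpace I : Θ → Type _) x).symmL ℝ θ

variable (I) in
/-- The coordinates of a tangent vector in the chart at `x`. -/
def chartCoord [IsManifold I ∞ Θ] (x θ : Θ) : TangentSpace I θ →L[ℝ] EuclideanSpace ℝ (Fin p) :=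
  (trivializationAt (EuclideanSpace ℝ (Fin p)) (TangentSpace I : Θ → Type _)
    x).continuousLinearMapAt ℝ θ

variable [IsManifold I ∞ Θ]

theorem mem_baseSet_of_mem_source {x θ : Θ} (h : θ ∈ (extChartAt I x).source) :
    θ ∈ (trivializationAt (EuclideanSpace ℝ (Fin p)) (TangentSpace I : Θ → Type _) x).baseSet := by
  rw [extChartAt_source] at h
  exact h

theorem chartCoord_chartFrame {x θ : Θ} (h : θ ∈ (extChartAt I x).source)
    (v : EuclideanSpace ℝ (Fin p)) : chartCoord I x θ (chartFrame I x θ v) = v :=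
  Trivialization.continuousLinearMapAt_symmL _ (mem_baseSet_of_mem_source h) v

theorem chartFrame_chartCoord {x θ : Θ} (h : θ ∈ (extChartAt I x).source)
    (v : TangentSpace I θ) : chartFrame I x θ (chartCoord I x θ v) = v :=
  Trivialization.symmL_continuousLinearMapAt _ (mem_baseSet_of_mem_source h) v

theorem chartCoord_eq_mfderiv {x θ : Θ} (h : θ ∈ (extChartAt I x).source) :
    chartCoord I x θ = mfderiv I 𝓘(ℝ, EuclideanSpace ℝ (Fin p)) (extChartAt I x) θ :=
  TangentBundle.continuousLinearMapAt_trivializationAt (by rwa [extChartAt_source] at h)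

theorem chartFrame_eq_mfderivWithin {x : Θ} {y : EuclideanSpace ℝ (Fin p)}
    (hy : y ∈ (extChartAt I x).target) :
    chartFrame I x ((extChartAt I x).symm y) =
      mfderivWithin 𝓘(ℝ, EuclideanSpace ℝ (Fin p)) I (extChartAt I x).symm (range I) y := by
  have h := (extChartAt I x).map_target hy
  have := TangentBundle.symmL_trivializationAt (I := I) (x₀ := x)
    (x := (extChartAt I x).symm y) (by rwa [extChartAt_source] at h)
  rw [(extChartAt I x).right_inv hy] at this
  exact this

theorem coordField_eq {x : Θ} {y : EuclideanSpace ℝ (Fin p)}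
    (hy : y ∈ (extChartAt I x).target) (w : VField I Θ) :
    coordField w x y =
      chartCoord I x ((extChartAt I x).symm y) (w ((extChartAt I x).symm y)) := by
  rw [chartCoord_eq_mfderiv ((extChartAt I x).map_target hy)]
  rfl

theorem coordVec_eq {x : Θ} {y : EuclideanSpace ℝ (Fin p)}
    (hy : y ∈ (extChartAt I x).target) (a : Fin p) :
    coordVec I x y a = chartFrame I x ((extChartAt I x).symm y) (EuclideanSpace.single a 1) := by
  rw [chartFrame_eq_mfderivWithin hy]
  rfl

theorem hasMFDerivAt_extChartAt_symm {x : Θ} {y : EuclideanSpace ℝ (Fin p)}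
    (hy : y ∈ interior (extChartAt I x).target) :
    HasMFDerivAt 𝓘(ℝ, EuclideanSpace ℝ (Fin p)) I (extChartAt I x).symm y
      (chartFrame I x ((extChartAt I x).symm y)) := by
  have h := (mdifferentiableWithinAt_extChartAt_symm (I := I)
    (interior_subset hy)).hasMFDerivWithinAt.hasMFDerivAt (range_mem_nhds hy)
  rwa [← chartFrame_eq_mfderivWithin (interior_subset hy)] at h

theorem hasFDerivAt_comp_extChartAt_symm {x : Θ} {y : EuclideanSpace ℝ (Fin p)}
    (hy : y ∈ interior (extChartAt I x).target) {h : Θ → ℝ}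
    (hh : MDifferentiableAt I 𝓘(ℝ, ℝ) h ((extChartAt I x).symm y)) :
    HasFDerivAt (fun z => h ((extChartAt I x).symm z))
      ((dif (I := I) h ((extChartAt I x).symm y)).comp
        (chartFrame I x ((extChartAt I x).symm y))) y :=
  (hh.hasMFDerivAt.comp y (hasMFDerivAt_extChartAt_symm hy)).hasFDerivAt

theorem hasFDerivAt_chart_transition {x x' : Θ} {y : EuclideanSpace ℝ (Fin p)}
    (hy : y ∈ interior (extChartAt I x).target)
    (hy' : (extChartAt I x).symm y ∈ (extChartAt I x').source) :
    HasFDerivAt (fun z => extChartAt I x' ((extChartAt I x).symm z))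
      ((chartCoord I x' ((extChartAt I x).symm y)).comp
        (chartFrame I x ((extChartAt I x).symm y))) y := by
  have h := (mdifferentiableAt_extChartAt (I := I) (x := x') (y := (extChartAt I x).symm y)
    (by rwa [extChartAt_source] at hy')).hasMFDerivAt
  rw [← chartCoord_eq_mfderiv hy'] at h
  exact (h.comp y (hasMFDerivAt_extChartAt_symm hy)).hasFDerivAt

theorem fderiv_comp_extChartAt_symm_coordField {x : Θ} {y : EuclideanSpace ℝ (Fin p)}
    (hy : y ∈ interior (extChartAt I x).target) {h : Θ → ℝ}
    (hh : MDifferentiableAt I 𝓘(ℝ, ℝ) h ((extChartAt I x).symm y)) (w : VField I Θ) :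
    fderiv ℝ (fun z => h ((extChartAt I x).symm z)) y (coordField w x y) =
      dif (I := I) h ((extChartAt I x).symm y) (w ((extChartAt I x).symm y)) := by
  rw [(hasFDerivAt_comp_extChartAt_symm hy hh).fderiv, coordField_eq (interior_subset hy),
    ContinuousLinearMap.comp_apply,
    chartFrame_chartCoord ((extChartAt I x).map_target (interior_subset hy))]

theorem contMDiffAt_extChartAt_symm_interior {x : Θ} {y : EuclideanSpace ℝ (Fin p)}
    (hy : y ∈ interior (extChartAt I x).target) :
    ContMDiffAt 𝓘(ℝ, EuclideanSpace ℝ (Fin p)) I ∞ (extChartAt I x).symm y :=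
  (contMDiffOn_extChartAt_symm x).contMDiffAt (mem_interior_iff_mem_nhds.1 hy)

theorem contDiffAt_comp_extChartAt_symm {F : Type*} [NormedAddCommGroup F] [NormedSpace ℝ F]
    {x : Θ} {y : EuclideanSpace ℝ (Fin p)} {n : ℕ∞ω} (hn : n ≤ ∞)
    (hy : y ∈ interior (extChartAt I x).target) {h : Θ → F}
    (hh : ContMDiffAt I 𝓘(ℝ, F) n h ((extChartAt I x).symm y)) :
    ContDiffAt ℝ n (fun z => h ((extChartAt I x).symm z)) y :=
  (hh.comp y ((contMDiffAt_extChartAt_symm_interior hy).of_le hn)).contDiffAt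

theorem contDiffAt_chart_transition {x x' : Θ} {y : EuclideanSpace ℝ (Fin p)}
    (hy : y ∈ interior (extChartAt I x).target)
    (hy' : (extChartAt I x).symm y ∈ (extChartAt I x').source) :
    ContDiffAt ℝ ∞ (fun z => extChartAt I x' ((extChartAt I x).symm z)) y :=
  contDiffAt_comp_extChartAt_symm le_rfl hy
    (contMDiffAt_extChartAt' (by rwa [extChartAt_source] at hy'))

theorem contDiffAt_coordField {x : Θ} {y : EuclideanSpace ℝ (Fin p)}
    (hy : y ∈ interior (extChartAt I x).target) {w : VField I Θ}
    (hw : ContMDiffOn I I.tangent 1 (fun θ => (⟨θ, w θ⟩ : TangentBundle I Θ)) (I.interior Θ)) :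
    ContDiffAt ℝ 1 (coordField w x) y := by
  have hs := (extChartAt I x).map_target (interior_subset hy)
  have hi := (extChartAt_symm_mem_interior_iff (interior_subset hy)).2 hy
  have h1 := (Trivialization.contMDiffAt_section_iff (IB := I) (n := 1)
    (e := trivializationAt (EuclideanSpace ℝ (Fin p)) (TangentSpace I : Θ → Type _) x)
    (mem_baseSet_of_mem_source hs)).1 ((hw _ hi).contMDiffAt (interior_mem_nhds hi))
  refine (contDiffAt_comp_extChartAt_symm (by simp) hy h1).congr_of_eventuallyEq ?_
  filter_upwards [isOpen_interior.mem_nhds hy] with z hz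
  rw [coordField_eq (interior_subset hz)]
  exact Trivialization.continuousLinearMapAt_apply_of_mem _ _
    (mem_baseSet_of_mem_source ((extChartAt I x).map_target (interior_subset hz))) _

theorem continuousOn_coordField {x : Θ} {w : VField I Θ}
    (hw : Continuous (fun θ => (⟨θ, w θ⟩ : TangentBundle I Θ))) :
    ContinuousOn (coordField w x) (extChartAt I x).target := by
  set e := trivializationAt (EuclideanSpace ℝ (Fin p)) (TangentSpace I : Θ → Type _) x
  have h1 : ContinuousOn (fun θ => (e ⟨θ, w θ⟩).2) (extChartAt I x).source :=
    continuous_snd.comp_continuousOn (e.continuousOn_toFun.comp hw.continuousOn fun θ hθ =>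
      e.mem_source.2 (mem_baseSet_of_mem_source hθ))
  refine (h1.comp (continuousOn_extChartAt_symm x) fun y hy =>
    (extChartAt I x).map_target hy).congr fun y hy => ?_
  rw [coordField_eq hy]
  exact Trivialization.continuousLinearMapAt_apply_of_mem _ _
    (mem_baseSet_of_mem_source ((extChartAt I x).map_target hy)) _

/-! ### The volume density in charts -/

/-- The metric at `θ` in the coordinates given by the chart at `x`. -/
def chartMetric (g : Metric I Θ) (x θ : Θ) : LinearMap.BilinForm ℝ (EuclideanSpace ℝ (Fin p)) :=
  LinearMap.mk₂ ℝ (fun v w => g.inner θ (chartFrame I x θ v) (chartFrame I x θ w))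
    (by simp) (by simp) (by simp) (by simp)

theorem chartMetric_apply (g : Metric I Θ) (x θ : Θ) (v w : EuclideanSpace ℝ (Fin p)) :
    chartMetric g x θ v w = g.inner θ (chartFrame I x θ v) (chartFrame I x θ w) := rfl

/-- `√|g|` in the chart at `x`, at the point `θ`. -/
def volDensity (g : Metric I Θ) (x θ : Θ) : ℝ :=
  Real.sqrt (LinearMap.BilinForm.toMatrix (EuclideanSpace.basisFun (Fin p) ℝ).toBasis
    (chartMetric g x θ)).det

theorem sqrtDet_eq (g : Metric I Θ) {x : Θ} {y : EuclideanSpace ℝ (Fin p)}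
    (hy : y ∈ (extChartAt I x).target) :
    sqrtDet g x y = volDensity g x ((extChartAt I x).symm y) := by
  rw [sqrtDet, volDensity]
  congr 2
  ext a b
  simp [LinearMap.BilinForm.toMatrix_apply, coordVec_eq hy, chartMetric_apply]
  rfl

theorem det_chartMetric_pos (g : Metric I Θ) {x θ : Θ} (h : θ ∈ (extChartAt I x).source) :
    0 < (LinearMap.BilinForm.toMatrix (EuclideanSpace.basisFun (Fin p) ℝ).toBasis
      (chartMetric g x θ)).det := by
  refine Matrix.PosDef.det_pos (Matrix.PosDef.of_dotProduct_mulVec_pos ?_ fun v hv => ?_)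
  · ext a b
    simp [LinearMap.BilinForm.toMatrix_apply, chartMetric_apply, g.symm θ]
  · rw [star_trivial, LinearMap.BilinForm.dotProduct_toMatrix_mulVec, chartMetric_apply]
    refine g.pos θ _ fun h0 => hv ?_
    have h1 := chartCoord_chartFrame h
      ((EuclideanSpace.basisFun (Fin p) ℝ).toBasis.equivFun.symm v)
    rw [h0, map_zero] at h1
    exact (LinearEquiv.map_eq_zero_iff _).1 h1.symm

theorem volDensity_pos (g : Metric I Θ) {x θ : Θ} (h : θ ∈ (extChartAt I x).source) :
    0 < volDensity g x θ :=
  Real.sqrt_pos.2 (det_chartMetric_pos g h)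

theorem sqrtDet_pos (g : Metric I Θ) {x : Θ} {y : EuclideanSpace ℝ (Fin p)}
    (hy : y ∈ (extChartAt I x).target) : 0 < sqrtDet g x y := by
  rw [sqrtDet_eq g hy]
  exact volDensity_pos g ((extChartAt I x).map_target hy)

/-- The coordinate frame is constant in the trivialization, hence smooth, so the Gram matrix has
smooth entries; its determinant is positive, where the square root is smooth. -/
theorem contMDiffAt_volDensity (g : Metric I Θ) {x θ : Θ} (h : θ ∈ (extChartAt I x).source) :
    ContMDiffAt I 𝓘(ℝ, ℝ) ∞ (volDensity g x) θ := by
  have hb := mem_baseSet_of_mem_source h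
  have hframe : ∀ v, ContMDiffAt I I.tangent ∞
      (fun θ => (⟨θ, chartFrame I x θ v⟩ : TangentBundle I Θ)) θ := by
    intro v
    refine (Trivialization.contMDiffAt_section_iff (IB := I) (n := ∞)
      (e := trivializationAt (EuclideanSpace ℝ (Fin p)) (TangentSpace I : Θ → Type _) x)
      hb).2 ?_
    refine (contMDiffAt_const (c := v)).congr_of_eventuallyEq ?_
    filter_upwards [(trivializationAt (EuclideanSpace ℝ (Fin p)) (TangentSpace I : Θ → Type _)
      x).open_baseSet.mem_nhds hb] with z hz
    rw [← Trivialization.continuousLinearMapAt_apply_of_mem ℝ _ hz]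
    exact Trivialization.continuousLinearMapAt_symmL _ hz v
  have hentry : ∀ a b, ContMDiffAt I 𝓘(ℝ, ℝ) ∞ (fun θ =>
      LinearMap.BilinForm.toMatrix (EuclideanSpace.basisFun (Fin p) ℝ).toBasis
        (chartMetric g x θ) a b) θ := by
    intro a b
    simp only [LinearMap.BilinForm.toMatrix_apply, chartMetric_apply]
    have h1 : ContMDiffAt I (I.prod 𝓘(ℝ, ℝ)) ∞
        (fun m => TotalSpace.mk' ℝ (E := Bundle.Trivial Θ ℝ) m
          (g.inner m (chartFrame I x m ((EuclideanSpace.basisFun (Fin p) ℝ).toBasis a))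
            (chartFrame I x m ((EuclideanSpace.basisFun (Fin p) ℝ).toBasis b)))) θ := by
      apply ContMDiffAt.clm_bundle_apply₂ (F₁ := EuclideanSpace ℝ (Fin p))
        (F₂ := EuclideanSpace ℝ (Fin p))
      · exact g.contMDiff.contMDiffAt
      · exact hframe _
      · exact hframe _
    rw [contMDiffAt_totalSpace] at h1
    exact h1.2
  have hdet : ContMDiffAt I 𝓘(ℝ, ℝ) ∞ (fun θ =>
      (LinearMap.BilinForm.toMatrix (EuclideanSpace.basisFun (Fin p) ℝ).toBasis
        (chartMetric g x θ)).det) θ := by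
    simp_rw [Matrix.det_apply']
    refine contMDiffAt_finsetSum fun σ _ => ?_
    exact contMDiffAt_const.mul (contMDiffAt_finsetProd fun i _ => hentry _ _)
  exact ContDiffAt.comp_contMDiffAt (Real.contDiffAt_sqrt (det_chartMetric_pos g h).ne') hdet

theorem contDiffAt_sqrtDet (g : Metric I Θ) {x : Θ} {y : EuclideanSpace ℝ (Fin p)}
    (hy : y ∈ interior (extChartAt I x).target) : ContDiffAt ℝ ∞ (sqrtDet g x) y := by
  refine (contDiffAt_comp_extChartAt_symm le_rfl hy (contMDiffAt_volDensity g
    ((extChartAt I x).map_target (interior_subset hy)))).congr_of_eventuallyEq ?_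
  filter_upwards [isOpen_interior.mem_nhds hy] with z hz
  exact sqrtDet_eq g (interior_subset hz)

theorem continuousOn_sqrtDet (g : Metric I Θ) (x : Θ) :
    ContinuousOn (sqrtDet g x) (extChartAt I x).target := by
  have h : ContinuousOn (volDensity g x) (extChartAt I x).source := fun θ hθ =>
    (contMDiffAt_volDensity g hθ).continuousAt.continuousWithinAt
  exact (h.comp (continuousOn_extChartAt_symm x) fun y hy =>
    (extChartAt I x).map_target hy).congr fun y hy => sqrtDet_eq g hy

/-- The Gram matrices are congruent through the Jacobian `J`, so their determinants differ by the
factor `J.det ^ 2`. -/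
theorem volDensity_change (g : Metric I Θ) {x x' θ : Θ} (h' : θ ∈ (extChartAt I x').source) :
    volDensity g x θ =
      |((chartCoord I x' θ).comp (chartFrame I x θ)).det| * volDensity g x' θ := by
  set J := (chartCoord I x' θ).comp (chartFrame I x θ)
  set b := (EuclideanSpace.basisFun (Fin p) ℝ).toBasis
  have h1 : chartMetric g x θ = (chartMetric g x' θ).comp (J : _ →ₗ[ℝ] _) (J : _ →ₗ[ℝ] _) := by
    ext v w
    simp [chartMetric_apply, J, chartFrame_chartCoord h']
  rw [volDensity, h1, LinearMap.BilinForm.toMatrix_comp b b, Matrix.det_mul, Matrix.det_mul,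
    Matrix.det_transpose, LinearMap.det_toMatrix, volDensity, ← Real.sqrt_sq_eq_abs,
    ← Real.sqrt_mul (sq_nonneg _)]
  congr 1
  ring

end Charts

/-! ### The divergence in charts -/

theorem euclDiv_smul {p : ℕ} {q : EuclideanSpace ℝ (Fin p) → ℝ}
    {N : EuclideanSpace ℝ (Fin p) → EuclideanSpace ℝ (Fin p)} {y : EuclideanSpace ℝ (Fin p)}
    (hq : DifferentiableAt ℝ q y) (hN : DifferentiableAt ℝ N y) :
    euclDiv (fun z => q z • N z) y = q y * euclDiv N y + fderiv ℝ q y (N y) := by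
  have h : HasFDerivAt (fun z => q z • N z) _ y := hq.hasFDerivAt.smul hN.hasFDerivAt
  rw [euclDiv_eq_trace hN, euclDiv_eq_trace h.differentiableAt, h.fderiv]
  have e : ((q y • fderiv ℝ N y + (fderiv ℝ q y).smulRight (N y) :
      EuclideanSpace ℝ (Fin p) →L[ℝ] EuclideanSpace ℝ (Fin p)) :
      EuclideanSpace ℝ (Fin p) →ₗ[ℝ] EuclideanSpace ℝ (Fin p)) =
      q y • (fderiv ℝ N y : EuclideanSpace ℝ (Fin p) →ₗ[ℝ] EuclideanSpace ℝ (Fin p)) +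
        LinearMap.smulRight (fderiv ℝ q y : EuclideanSpace ℝ (Fin p) →ₗ[ℝ] ℝ) (N y) := rfl
  rw [e, map_add, map_smul, LinearMap.trace_smulRight]
  rfl

theorem euclDiv_add_smul {p : ℕ} {M N : EuclideanSpace ℝ (Fin p) → EuclideanSpace ℝ (Fin p)}
    {y : EuclideanSpace ℝ (Fin p)} (a b : ℝ)
    (hM : DifferentiableAt ℝ M y) (hN : DifferentiableAt ℝ N y) :
    euclDiv (fun z => a • M z + b • N z) y = a * euclDiv M y + b * euclDiv N y := by
  have h : HasFDerivAt (fun z => a • M z + b • N z) _ y :=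
    (hM.hasFDerivAt.const_smul a).add (hN.hasFDerivAt.const_smul b)
  rw [euclDiv_eq_trace hM, euclDiv_eq_trace hN, euclDiv_eq_trace h.differentiableAt, h.fderiv]
  have e : ((a • fderiv ℝ M y + b • fderiv ℝ N y :
      EuclideanSpace ℝ (Fin p) →L[ℝ] EuclideanSpace ℝ (Fin p)) :
      EuclideanSpace ℝ (Fin p) →ₗ[ℝ] EuclideanSpace ℝ (Fin p)) =
      a • (fderiv ℝ M y : EuclideanSpace ℝ (Fin p) →ₗ[ℝ] EuclideanSpace ℝ (Fin p)) +
      b • (fderiv ℝ N y : EuclideanSpace ℝ (Fin p) →ₗ[ℝ] EuclideanSpace ℝ (Fin p)) := rfl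
  rw [e, map_add, map_smul, map_smul]
  rfl

theorem continuousAt_euclDiv {p : ℕ} {N : EuclideanSpace ℝ (Fin p) → EuclideanSpace ℝ (Fin p)}
    {y : EuclideanSpace ℝ (Fin p)} (hN : ContDiffAt ℝ 1 N y) : ContinuousAt (euclDiv N) y := by
  refine tendsto_finsetSum _ fun a _ => ?_
  have h1 : ContDiffAt ℝ 1 (fun z => N z a) y :=
    (EuclideanSpace.proj (𝕜 := ℝ) a).contDiff.contDiffAt.comp y hN
  exact (h1.fderiv_right (m := 0) (by simp)).continuousAt.clm_apply continuousAt_const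

section Charts

variable {p : ℕ} {H : Type*} [TopologicalSpace H]
  {I : ModelWithCorners ℝ (EuclideanSpace ℝ (Fin p)) H}
  {Θ : Type*} [TopologicalSpace Θ] [ChartedSpace H Θ] [IsManifold I ∞ Θ]

/-- The vector density `√|g| w^a` in the chart at `x`. -/
def coordDensity (g : Metric I Θ) (w : VField I Θ) (x : Θ) (y : EuclideanSpace ℝ (Fin p)) :
    EuclideanSpace ℝ (Fin p) :=
  sqrtDet g x y • coordField w x y

theorem contDiffAt_coordDensity (g : Metric I Θ) {x : Θ} {y : EuclideanSpace ℝ (Fin p)}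
    (hy : y ∈ interior (extChartAt I x).target) {w : VField I Θ}
    (hw : ContMDiffOn I I.tangent 1 (fun θ => (⟨θ, w θ⟩ : TangentBundle I Θ)) (I.interior Θ)) :
    ContDiffAt ℝ 1 (coordDensity g w x) y :=
  ((contDiffAt_sqrtDet g hy).of_le (by simp)).smul (contDiffAt_coordField hy hw)

theorem divergence_eq_self (g : Metric I Θ) (w : VField I Θ) {θ : Θ} (h : θ ∈ I.interior Θ) :
    divergence g w θ = (sqrtDet g θ (extChartAt I θ θ))⁻¹ *
      euclDiv (coordDensity g w θ) (extChartAt I θ θ) := by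
  have hy := (extChartAt_mem_interior_iff (mem_extChartAt_source (I := I) θ)).2 h
  rw [divergence, euclDiv]
  congr 1
  refine Finset.sum_congr rfl fun a _ => ?_
  rw [fderivWithin_of_mem_nhds (range_mem_nhds hy)]
  rfl

/-- Components of `w` are pushed forward by the derivative of the transition map and $\sqrt{|g|}$
scales by its absolute Jacobian determinant. So the vector densities of the two charts satisfy
exactly the hypothesis of the Piola identity. -/
theorem euclDiv_coordDensity_transition (g : Metric I Θ) {w : VField I Θ}
    (hw : ContMDiffOn I I.tangent 1 (fun θ => (⟨θ, w θ⟩ : TangentBundle I Θ)) (I.interior Θ))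
    {x x' : Θ} {y : EuclideanSpace ℝ (Fin p)} (hy : y ∈ interior (extChartAt I x).target)
    (hy' : (extChartAt I x).symm y ∈ (extChartAt I x').source) :
    (sqrtDet g x y)⁻¹ * euclDiv (coordDensity g w x) y =
      (sqrtDet g x' (extChartAt I x' ((extChartAt I x).symm y)))⁻¹ *
        euclDiv (coordDensity g w x') (extChartAt I x' ((extChartAt I x).symm y)) := by
  set τ := fun z => extChartAt I x' ((extChartAt I x).symm z) with hτ
  have hτy : τ y ∈ interior (extChartAt I x').target := by
    rw [hτ, extChartAt_mem_interior_iff hy']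
    exact (extChartAt_symm_mem_interior_iff (interior_subset hy)).2 hy
  have hsd : ∀ z, z ∈ interior (extChartAt I x).target →
      (extChartAt I x).symm z ∈ (extChartAt I x').source →
      sqrtDet g x z = |(fderiv ℝ τ z).det| * sqrtDet g x' (τ z) := by
    intro z hz hz'
    rw [sqrtDet_eq g (interior_subset hz), sqrtDet_eq g ((extChartAt I x').map_source hz'), hτ,
      (extChartAt I x').left_inv hz', (hasFDerivAt_chart_transition hz hz').fderiv,
      volDensity_change g hz']
  have hN := contDiffAt_coordDensity g hy hw
  have hR := contDiffAt_coordDensity g hτy hw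
  have hd : (fderiv ℝ τ y).det ≠ 0 := by
    intro h0
    have h1 := hsd y hy hy'
    rw [h0, abs_zero, zero_mul] at h1
    exact (sqrtDet_pos g (interior_subset hy)).ne' h1
  have key := trace_fderiv_piola (τ := τ) (N := coordDensity g w x) (R := coordDensity g w x')
    ((contDiffAt_chart_transition hy hy').of_le (by norm_cast))
    (hN.differentiableAt one_ne_zero) (hR.differentiableAt one_ne_zero) (by
      filter_upwards [isOpen_interior.mem_nhds hy,
        (continuousAt_extChartAt_symm_interior hy).preimage_mem_nhds
          ((isOpen_extChartAt_source x').mem_nhds hy')] with z hz hz'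
      have hz'' : (extChartAt I x).symm z ∈ (extChartAt I x').source := hz'
      rw [coordDensity, coordDensity, map_smul, smul_smul, ← hsd z hz hz',
        (hasFDerivAt_chart_transition hz hz').fderiv, coordField_eq (interior_subset hz),
        coordField_eq ((extChartAt I x').map_source hz''), ContinuousLinearMap.comp_apply,
        chartFrame_chartCoord ((extChartAt I x).map_target (interior_subset hz)),
        (extChartAt I x').left_inv hz'']) hd
  rw [← euclDiv_eq_trace (hN.differentiableAt one_ne_zero),
    ← euclDiv_eq_trace (hR.differentiableAt one_ne_zero)] at key
  change _ = (sqrtDet g x' (τ y))⁻¹ * euclDiv (coordDensity g w x') (τ y)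
  rw [key, hsd y hy hy']
  have h2 : |(fderiv ℝ τ y).det| ≠ 0 := abs_ne_zero.2 hd
  have h3 : sqrtDet g x' (τ y) ≠ 0 := (sqrtDet_pos g (interior_subset hτy)).ne'
  field_simp

/-- The divergence can be computed in any chart. -/
theorem divergence_eq (g : Metric I Θ) {w : VField I Θ}
    (hw : ContMDiffOn I I.tangent 1 (fun θ => (⟨θ, w θ⟩ : TangentBundle I Θ)) (I.interior Θ))
    {x : Θ} {y : EuclideanSpace ℝ (Fin p)} (hy : y ∈ interior (extChartAt I x).target) :
    divergence g w ((extChartAt I x).symm y) =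
      (sqrtDet g x y)⁻¹ * euclDiv (coordDensity g w x) y := by
  rw [euclDiv_coordDensity_transition g hw hy (mem_extChartAt_source _)]
  exact divergence_eq_self g w ((extChartAt_symm_mem_interior_iff (interior_subset hy)).2 hy)

/-- The definition evaluates each point in its own preferred chart, so continuity is not visible
there; chart independence allows one fixed chart near `θ`. -/
theorem continuousOn_divergence (g : Metric I Θ) {w : VField I Θ}
    (hw : ContMDiffOn I I.tangent 1 (fun θ => (⟨θ, w θ⟩ : TangentBundle I Θ)) (I.interior Θ)) :
    ContinuousOn (divergence g w) (I.interior Θ) := by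
  intro θ hθ
  refine ContinuousAt.continuousWithinAt ?_
  have hy := (extChartAt_mem_interior_iff (mem_extChartAt_source (I := I) θ)).2 hθ
  have h1 : ContinuousAt (fun y => (sqrtDet g θ y)⁻¹ * euclDiv (coordDensity g w θ) y)
      (extChartAt I θ θ) :=
    ((contDiffAt_sqrtDet g hy).continuousAt.inv₀ (sqrtDet_pos g (interior_subset hy)).ne').mul
      (continuousAt_euclDiv (contDiffAt_coordDensity g hy hw))
  refine (h1.comp (continuousAt_extChartAt θ)).congr ?_
  filter_upwards [interior_mem_nhds hθ, extChartAt_source_mem_nhds (I := I) θ] with z hz hz'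
  have hzi := (extChartAt_mem_interior_iff hz').2 hz
  have := divergence_eq g hw hzi
  rw [(extChartAt I θ).left_inv hz'] at this
  exact this.symm

theorem divergence_add_smul (g : Metric I Θ) {v w : VField I Θ} (a b : ℝ)
    (hv : ContMDiffOn I I.tangent 1 (fun θ => (⟨θ, v θ⟩ : TangentBundle I Θ)) (I.interior Θ))
    (hw : ContMDiffOn I I.tangent 1 (fun θ => (⟨θ, w θ⟩ : TangentBundle I Θ)) (I.interior Θ))
    {θ : Θ} (hθ : θ ∈ I.interior Θ) :
    divergence g (fun θ => a • v θ + b • w θ) θ = a * divergence g v θ + b * divergence g w θ := by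
  have hy := (extChartAt_mem_interior_iff (mem_extChartAt_source (I := I) θ)).2 hθ
  rw [divergence_eq_self g _ hθ, divergence_eq_self g _ hθ, divergence_eq_self g _ hθ]
  have e : coordDensity g (fun θ => a • v θ + b • w θ) θ =
      fun z => a • coordDensity g v θ z + b • coordDensity g w θ z := by
    funext z
    have : coordField (fun θ => a • v θ + b • w θ) θ z =
      a • coordField v θ z + b • coordField w θ z := by
        simp only [coordField]
        rw [map_add, map_smul, map_smul]
        rfl
    simp only [coordDensity, this, smul_add, smul_comm (sqrtDet g θ z)]
  rw [e, euclDiv_add_smul a b ((contDiffAt_coordDensity g hy hv).differentiableAt one_ne_zero)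
    ((contDiffAt_coordDensity g hy hw).differentiableAt one_ne_zero)]
  ring

theorem contMDiffOn_add_smul {v w : VField I Θ} (a b : ℝ)
    (hv : ContMDiffOn I I.tangent 1 (fun θ => (⟨θ, v θ⟩ : TangentBundle I Θ)) (I.interior Θ))
    (hw : ContMDiffOn I I.tangent 1 (fun θ => (⟨θ, w θ⟩ : TangentBundle I Θ)) (I.interior Θ)) :
    ContMDiffOn I I.tangent 1 (fun θ => (⟨θ, a • v θ + b • w θ⟩ : TangentBundle I Θ))
      (I.interior Θ) :=
  (hv.const_smul_section (a := a)).add_section (hw.const_smul_section (a := b))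

theorem contMDiffOn_smul_field {ρ : Θ → ℝ} (hρ : ContMDiffOn I 𝓘(ℝ, ℝ) 1 ρ (I.interior Θ))
    {v : VField I Θ}
    (hv : ContMDiffOn I I.tangent 1 (fun θ => (⟨θ, v θ⟩ : TangentBundle I Θ)) (I.interior Θ)) :
    ContMDiffOn I I.tangent 1 (fun θ => (⟨θ, ρ θ • v θ⟩ : TangentBundle I Θ)) (I.interior Θ) :=
  hρ.smul_section hv

theorem continuousOn_divρ (g : Metric I Θ) {ρ : Θ → ℝ}
    (hρ : ContMDiffOn I 𝓘(ℝ, ℝ) 1 ρ (I.interior Θ)) (hpos : ∀ θ ∈ I.interior Θ, 0 < ρ θ)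
    {v : VField I Θ}
    (hv : ContMDiffOn I I.tangent 1 (fun θ => (⟨θ, v θ⟩ : TangentBundle I Θ)) (I.interior Θ)) :
    ContinuousOn (divρ g ρ v) (I.interior Θ) :=
  (continuousOn_const.div hρ.continuousOn fun θ hθ => (hpos θ hθ).ne').mul
    (continuousOn_divergence g (contMDiffOn_smul_field hρ hv))

theorem divρ_add_smul (g : Metric I Θ) {ρ : Θ → ℝ}
    (hρ : ContMDiffOn I 𝓘(ℝ, ℝ) 1 ρ (I.interior Θ)) {v w : VField I Θ} (a b : ℝ)
    (hv : ContMDiffOn I I.tangent 1 (fun θ => (⟨θ, v θ⟩ : TangentBundle I Θ)) (I.interior Θ))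
    (hw : ContMDiffOn I I.tangent 1 (fun θ => (⟨θ, w θ⟩ : TangentBundle I Θ)) (I.interior Θ))
    {θ : Θ} (hθ : θ ∈ I.interior Θ) :
    divρ g ρ (fun θ => a • v θ + b • w θ) θ = a * divρ g ρ v θ + b * divρ g ρ w θ := by
  have e : (fun θ => ρ θ • (a • v θ + b • w θ)) =
      (fun θ => a • (ρ θ • v θ) + b • (ρ θ • w θ) : VField I Θ) := by
    funext θ
    rw [smul_add, smul_comm (ρ θ), smul_comm (ρ θ)]
  rw [divρ, e, divergence_add_smul g a b (contMDiffOn_smul_field hρ hv)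
    (contMDiffOn_smul_field hρ hw) hθ, divρ, divρ]
  ring

end Charts

/-! ### The Riemannian volume in charts -/

section Volume

variable {p : ℕ} {H : Type*} [TopologicalSpace H]
  {I : ModelWithCorners ℝ (EuclideanSpace ℝ (Fin p)) H}
  {Θ : Type*} [TopologicalSpace Θ] [ChartedSpace H Θ]

theorem measurableSet_target (x : Θ) : MeasurableSet (extChartAt I x).target := by
  rw [extChartAt_target]
  exact (((chartAt H x).open_target.preimage I.continuous_symm).measurableSet).inter
    I.isClosed_range.measurableSet

/-- The excluded points lie on the frontier of `range I`, and the frontier of a convex set is null.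
-/
theorem volume_target_diff_interior (x : Θ) :
    volume ((extChartAt I x).target \ interior (extChartAt I x).target) = 0 := by
  refine measure_mono_null ?_ (I.convex_range.addHaar_frontier volume)
  rintro y ⟨hy, hy'⟩
  refine ⟨subset_closure (extChartAt_target_subset_range x hy), fun h => hy' ?_⟩
  rw [extChartAt_target] at hy ⊢
  rw [interior_inter,
    ((chartAt H x).open_target.preimage I.continuous_symm).interior_eq]
  exact ⟨hy.1, h⟩

theorem restrict_target_eq_interior (x : Θ) :
    volume.restrict (extChartAt I x).target = volume.restrict (interior (extChartAt I x).target) :=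
  Measure.restrict_congr_set <| by
    refine (ae_eq_set.2 ⟨volume_target_diff_interior x, ?_⟩)
    rw [sdiff_eq_empty.2 interior_subset, measure_empty]

theorem measurableSet_preimage_extChartAt_symm [MeasurableSpace Θ] [BorelSpace Θ] (x : Θ) {B : Set Θ}
    (hB : MeasurableSet B) :
    MeasurableSet ((extChartAt I x).symm ⁻¹' B ∩ interior (extChartAt I x).target) := by
  have h1 : Measurable ((interior (extChartAt I x).target).domRestrict (extChartAt I x).symm) :=
    (continuousOn_iff_continuous_domRestrict.1
      ((continuousOn_extChartAt_symm x).mono interior_subset)).measurable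
  have h2 := isOpen_interior.measurableSet.subtype_image (h1 hB)
  convert h2 using 1
  ext y
  exact ⟨fun h => ⟨⟨y, h.2⟩, h.1, rfl⟩, by rintro ⟨z, hz, rfl⟩; exact ⟨hz, z.2⟩⟩

variable [IsManifold I ∞ Θ]

theorem aemeasurable_ofReal_sqrtDet (g : Metric I Θ) (x : Θ) :
    AEMeasurable (fun y => ENNReal.ofReal (sqrtDet g x y))
      (volume.restrict (extChartAt I x).target) :=
  ((continuousOn_sqrtDet g x).aemeasurable (measurableSet_target x)).ennreal_ofReal

variable [MeasurableSpace Θ]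

theorem aemeasurable_extChartAt_symm [BorelSpace Θ] (g : Metric I Θ) (x : Θ) :
    AEMeasurable (extChartAt I x).symm ((volume.restrict (extChartAt I x).target).withDensity
      fun y => ENNReal.ofReal (sqrtDet g x y)) :=
  ((continuousOn_extChartAt_symm x).aemeasurable (measurableSet_target x)).mono_ac
    (withDensity_absolutelyContinuous _ _)

theorem chartVolume_apply [BorelSpace Θ] (g : Metric I Θ) (x : Θ) {B : Set Θ}
    (hB : MeasurableSet B) :
    chartVolume g x B = ∫⁻ y in (extChartAt I x).symm ⁻¹' B ∩ (extChartAt I x).target,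
      ENNReal.ofReal (sqrtDet g x y) := by
  rw [chartVolume, Measure.map_apply_of_aemeasurable (aemeasurable_extChartAt_symm g x) hB,
    withDensity_apply', Measure.restrict_restrict' (measurableSet_target x)]

theorem chartVolume_apply_interior [BorelSpace Θ] (g : Metric I Θ) (x : Θ) {B : Set Θ}
    (hB : MeasurableSet B) :
    chartVolume g x B = ∫⁻ y in (extChartAt I x).symm ⁻¹' B ∩ interior (extChartAt I x).target,
      ENNReal.ofReal (sqrtDet g x y) := by
  rw [chartVolume_apply g x hB, ← Measure.restrict_restrict' (measurableSet_target x),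
    restrict_target_eq_interior, Measure.restrict_restrict' isOpen_interior.measurableSet]

/-- Change of variables. Both integrals may be restricted to the interiors of the chart targets,
where the transition map is differentiable and its Jacobian is the factor in `volDensity_change`. -/
theorem chartVolume_overlap [BorelSpace Θ] (g : Metric I Θ) (x x' : Θ) {B : Set Θ}
    (hB : MeasurableSet B) (h : B ⊆ (extChartAt I x).source) (h' : B ⊆ (extChartAt I x').source) :
    chartVolume g x B = chartVolume g x' B := by
  rw [chartVolume_apply_interior g x hB, chartVolume_apply_interior g x' hB]
  set S := (extChartAt I x).symm ⁻¹' B ∩ interior (extChartAt I x).target with hS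
  set τ := fun z => extChartAt I x' ((extChartAt I x).symm z) with hτ
  have himg : τ '' S = (extChartAt I x').symm ⁻¹' B ∩ interior (extChartAt I x').target := by
    ext z
    constructor
    · rintro ⟨y, ⟨hyB, hyi⟩, rfl⟩
      have hyB' : (extChartAt I x).symm y ∈ B := hyB
      refine ⟨?_, (extChartAt_mem_interior_iff (h' hyB)).2
        ((extChartAt_symm_mem_interior_iff (interior_subset hyi)).2 hyi)⟩
      rw [mem_preimage, hτ, (extChartAt I x').left_inv (h' hyB)]
      exact hyB'
    · rintro ⟨hzB, hzi⟩
      have hzB' : (extChartAt I x').symm z ∈ B := hzB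
      refine ⟨extChartAt I x ((extChartAt I x').symm z), ⟨?_, ?_⟩, ?_⟩
      · rw [mem_preimage, (extChartAt I x).left_inv (h hzB)]
        exact hzB'
      · exact (extChartAt_mem_interior_iff (h hzB)).2
          ((extChartAt_symm_mem_interior_iff (interior_subset hzi)).2 hzi)
      · simp only [hτ]
        rw [(extChartAt I x).left_inv (h hzB), (extChartAt I x').right_inv (interior_subset hzi)]
  rw [← himg, lintegral_image_eq_lintegral_abs_det_fderiv_mul volume
    (measurableSet_preimage_extChartAt_symm x hB)
    (fun y hy => (hasFDerivAt_chart_transition hy.2 (h' hy.1)).hasFDerivWithinAt)]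
  · refine setLIntegral_congr_fun (measurableSet_preimage_extChartAt_symm x hB) fun y hy => ?_
    have hy' : (extChartAt I x).symm y ∈ (extChartAt I x').source := h' hy.1
    simp only
    rw [← ENNReal.ofReal_mul (abs_nonneg _), sqrtDet_eq g (interior_subset hy.2),
      sqrtDet_eq g ((extChartAt I x').map_source hy'), (extChartAt I x').left_inv hy',
      volDensity_change g hy']
  · intro y hy z hz hyz
    have h1 : (extChartAt I x).symm y = (extChartAt I x).symm z :=
      (extChartAt I x').injOn (h' hy.1) (h' hz.1) hyz
    exact (extChartAt I x).symm.injOn (interior_subset hy.2) (interior_subset hz.2) h1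

theorem chartVolume_restrict_source [BorelSpace Θ] (g : Metric I Θ) (x : Θ) :
    (chartVolume g x).restrict (extChartAt I x).source = chartVolume g x := by
  refine Measure.restrict_eq_self_of_ae_mem ?_
  rw [ae_iff]
  have hm : MeasurableSet {θ | θ ∉ (extChartAt I x).source} :=
    (isOpen_extChartAt_source x).measurableSet.compl
  rw [chartVolume_apply g x hm]
  have : (extChartAt I x).symm ⁻¹' {θ | θ ∉ (extChartAt I x).source} ∩ (extChartAt I x).target
      = ∅ := by
    ext y
    simp only [mem_inter_iff, mem_preimage, mem_ofPred_eq, mem_empty_iff_false, iff_false, not_and]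
    exact fun hy hy' => hy ((extChartAt I x).map_target hy')
  rw [this]
  simp

/-- A supremum of measures is not computed set by set, so an upper bound is exhibited: every chart
measure is at most `chartVolume g x` plus the part of `riemVolume g` off the source of `x`. The
supremum obeys the same bound, and restriction to the source kills the second term. -/
theorem riemVolume_restrict_source [BorelSpace Θ] (g : Metric I Θ) (x : Θ) :
    (riemVolume g).restrict (extChartAt I x).source = chartVolume g x := by
  have hx : MeasurableSet (extChartAt I x).source := (isOpen_extChartAt_source x).measurableSet
  have hle : ∀ x', (chartVolume g x').restrict (extChartAt I x).source ≤ chartVolume g x := by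
    refine fun x' => Measure.le_iff.2 fun B hB => ?_
    have hx' : MeasurableSet (extChartAt I x').source :=
      (isOpen_extChartAt_source x').measurableSet
    rw [Measure.restrict_apply hB, ← chartVolume_restrict_source g x',
      Measure.restrict_apply (hB.inter hx), chartVolume_overlap g x' x ((hB.inter hx).inter hx')
        inter_subset_right (inter_subset_left.trans inter_subset_right)]
    exact measure_mono (inter_subset_left.trans inter_subset_left)
  have hsup : riemVolume g ≤
      chartVolume g x + (riemVolume g).restrict (extChartAt I x).sourceᶜ := by
    refine iSup_le fun x' => ?_
    rw [← Measure.restrict_add_restrict_compl (μ := chartVolume g x') hx]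
    exact add_le_add (hle x') (Measure.restrict_mono le_rfl (le_iSup (chartVolume g) x'))
  refine le_antisymm ?_ ?_
  · refine (Measure.restrict_mono le_rfl hsup).trans ?_
    rw [Measure.restrict_add, Measure.restrict_restrict hx, inter_compl_self,
      Measure.restrict_empty, add_zero]
    exact Measure.restrict_le_self
  · rw [← chartVolume_restrict_source g x]
    exact Measure.restrict_mono le_rfl (le_iSup (chartVolume g) x)

/-- Second countability gives a countable cover by chart domains, and in each chart the boundary
misses the interior of the target, which carries all the mass. -/
theorem riemVolume_boundary [BorelSpace Θ] [SecondCountableTopology Θ] (g : Metric I Θ) :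
    riemVolume g (I.boundary Θ) = 0 := by
  obtain ⟨s, hs, hcov⟩ := TopologicalSpace.countable_cover_nhds
    (fun x : Θ => extChartAt_source_mem_nhds (I := I) x)
  have hm : MeasurableSet (I.boundary Θ) :=
    (I.isClosed_boundary (n := ∞) (by simp)).measurableSet
  have hsub : I.boundary Θ ⊆ ⋃ x ∈ s, I.boundary Θ ∩ (extChartAt I x).source := by
    rw [← inter_iUnion₂, hcov, inter_univ]
  refine measure_mono_null hsub ((measure_biUnion_null_iff hs).2 fun x _ => ?_)
  rw [← Measure.restrict_apply hm, riemVolume_restrict_source, chartVolume_apply_interior g x hm]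
  have : (extChartAt I x).symm ⁻¹' (I.boundary Θ) ∩ interior (extChartAt I x).target = ∅ := by
    ext y
    simp only [mem_inter_iff, mem_preimage, mem_empty_iff_false, iff_false, not_and]
    intro hy hy'
    rw [← I.compl_interior] at hy
    exact hy ((extChartAt_symm_mem_interior_iff (interior_subset hy')).2 hy')
  rw [this]
  simp

theorem ae_mem_interior [BorelSpace Θ] [SecondCountableTopology Θ] (g : Metric I Θ) :
    ∀ᵐ θ ∂(riemVolume g), θ ∈ I.interior Θ := by
  rw [ae_iff]
  exact (congrArg _ (I.compl_interior (M := Θ))).trans (riemVolume_boundary g)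

theorem riemVolume_pos [BorelSpace Θ] (g : Metric I Θ) {θ : Θ} (hθ : θ ∈ I.interior Θ)
    {U : Set Θ} (hU : U ∈ 𝓝 θ) : riemVolume g U ≠ 0 := by
  intro h0
  obtain ⟨V, hVU, hVo, hθV⟩ := mem_nhds_iff.1 hU
  have h1 : chartVolume g θ V = 0 := by
    rw [← riemVolume_restrict_source, Measure.restrict_apply hVo.measurableSet]
    exact measure_mono_null (inter_subset_left.trans hVU) h0
  have hy := (extChartAt_mem_interior_iff (mem_extChartAt_source (I := I) θ)).2 hθ
  rw [chartVolume_apply_interior g θ hVo.measurableSet, lintegral_eq_zero_iff'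
    ((aemeasurable_ofReal_sqrtDet g θ).mono_set (inter_subset_right.trans interior_subset)),
    Filter.EventuallyEq, ae_restrict_iff'
      (measurableSet_preimage_extChartAt_symm θ hVo.measurableSet)] at h1
  have hnhds : (extChartAt I θ).symm ⁻¹' V ∩ interior (extChartAt I θ).target ∈
      𝓝 (extChartAt I θ θ) := by
    refine inter_mem ?_ (isOpen_interior.mem_nhds hy)
    refine (continuousAt_extChartAt_symm_interior hy).preimage_mem_nhds ?_
    rw [extChartAt_to_inv]
    exact hVo.mem_nhds hθV
  refine (Measure.measure_pos_of_mem_nhds volume hnhds).ne' (measure_mono_null (fun y hy' => ?_) h1)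
  intro h2
  have h3 := h2 hy'
  simp only [Pi.zero_apply, ENNReal.ofReal_eq_zero] at h3
  exact absurd (sqrtDet_pos g (interior_subset hy'.2)) (not_lt.2 h3)

/-- A nonzero value would persist on a neighbourhood, which has positive volume. This makes the
equality case of Cauchy-Schwarz a pointwise statement. -/
theorem eq_zero_on_interior_of_ae [BorelSpace Θ] (g : Metric I Θ) {h : Θ → ℝ}
    (hc : ContinuousOn h (I.interior Θ)) (h0 : ∀ᵐ θ ∂(riemVolume g), h θ = 0) :
    ∀ θ ∈ I.interior Θ, h θ = 0 := by
  intro θ hθ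
  by_contra hne
  have h1 : {z | h z ≠ 0} ∈ 𝓝 θ :=
    (hc.continuousAt (interior_mem_nhds hθ)).eventually_ne hne
  exact riemVolume_pos g hθ h1 (ae_iff.1 h0)

theorem integrable_chart [BorelSpace Θ] (g : Metric I Θ) (x : Θ) {F : Θ → ℝ}
    (hF : Integrable F (riemVolume g)) :
    IntegrableOn (fun y => sqrtDet g x y * F ((extChartAt I x).symm y))
      (interior (extChartAt I x).target) := by
  have h1 : Integrable F (chartVolume g x) := by
    rw [← riemVolume_restrict_source]
    exact hF.restrict
  have h2 := h1.comp_aemeasurable (aemeasurable_extChartAt_symm g x)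
  rw [integrable_withDensity_iff_integrable_smul₀' (aemeasurable_ofReal_sqrtDet g x)
    (Eventually.of_forall fun _ => ENNReal.ofReal_lt_top), restrict_target_eq_interior] at h2
  refine h2.congr ((ae_restrict_iff' isOpen_interior.measurableSet).2
    (Eventually.of_forall fun y hy => ?_))
  simp [ENNReal.toReal_ofReal (sqrtDet_pos g (interior_subset hy)).le]

theorem integral_chart [BorelSpace Θ] (g : Metric I Θ) (x : Θ) {F : Θ → ℝ}
    (hF : Integrable F (riemVolume g)) (h0 : ∀ θ ∉ (extChartAt I x).source, F θ = 0) :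
    ∫ θ, F θ ∂(riemVolume g) = ∫ y in interior (extChartAt I x).target,
      sqrtDet g x y * F ((extChartAt I x).symm y) := by
  have h1 : Integrable F (chartVolume g x) := by
    rw [← riemVolume_restrict_source]
    exact hF.restrict
  rw [← setIntegral_eq_integral_of_forall_compl_eq_zero h0, riemVolume_restrict_source, chartVolume,
    integral_map (aemeasurable_extChartAt_symm g x) h1.aestronglyMeasurable,
    integral_withDensity_eq_integral_toReal_smul₀ (aemeasurable_ofReal_sqrtDet g x)
    (Eventually.of_forall fun _ => ENNReal.ofReal_lt_top), restrict_target_eq_interior]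
  refine setIntegral_congr_fun isOpen_interior.measurableSet fun y hy => ?_
  simp [ENNReal.toReal_ofReal (sqrtDet_pos g (interior_subset hy)).le]

end Volume

theorem euclDiv_congr {p : ℕ} {U V : EuclideanSpace ℝ (Fin p) → EuclideanSpace ℝ (Fin p)}
    {y : EuclideanSpace ℝ (Fin p)} (h : U =ᶠ[𝓝 y] V) : euclDiv U y = euclDiv V y := by
  refine Finset.sum_congr rfl fun a _ => ?_
  rw [Filter.EventuallyEq.fderiv_eq (h.mono fun z hz => congrArg (fun v => v a) hz)]

/-! ### Differentials on the interior -/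

section Differential

variable {p : ℕ} {H : Type*} [TopologicalSpace H]
  {I : ModelWithCorners ℝ (EuclideanSpace ℝ (Fin p)) H}
  {Θ : Type*} [TopologicalSpace Θ] [ChartedSpace H Θ]

theorem dif_congr {θ : Θ} {h k : Θ → ℝ} (e : h =ᶠ[𝓝 θ] k) :
    dif (I := I) h θ = dif (I := I) k θ := by
  have := e.mfderiv_eq (I := I) (I' := 𝓘(ℝ, ℝ))
  exact this

theorem dif_const (c : ℝ) (θ : Θ) : dif (I := I) (fun _ : Θ => c) θ = 0 :=
  mfderiv_const

variable [IsManifold I ∞ Θ]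

theorem dif_apply {θ : Θ} (hθ : θ ∈ I.interior Θ) {h : Θ → ℝ}
    (hh : MDifferentiableAt I 𝓘(ℝ, ℝ) h θ) (z : TangentSpace I θ) :
    HasFDerivAt (fun y => h ((extChartAt I θ).symm y))
      ((dif (I := I) h θ).comp (chartFrame I θ θ)) (extChartAt I θ θ) ∧
    dif (I := I) h θ z = fderiv ℝ (fun y => h ((extChartAt I θ).symm y)) (extChartAt I θ θ)
      (chartCoord I θ θ z) := by
  have hy := (extChartAt_mem_interior_iff (mem_extChartAt_source (I := I) θ)).2 hθ
  have h1 := hasFDerivAt_comp_extChartAt_symm (I := I) (x := θ) hy (h := h)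
  rw [extChartAt_to_inv] at h1
  refine ⟨h1 hh, ?_⟩
  rw [(h1 hh).fderiv, ContinuousLinearMap.comp_apply, chartFrame_chartCoord (mem_extChartAt_source θ)]

theorem dif_mul {θ : Θ} (hθ : θ ∈ I.interior Θ) {h k : Θ → ℝ}
    (hh : MDifferentiableAt I 𝓘(ℝ, ℝ) h θ) (hk : MDifferentiableAt I 𝓘(ℝ, ℝ) k θ)
    (z : TangentSpace I θ) :
    dif (I := I) (fun θ => h θ * k θ) θ z =
      h θ * dif (I := I) k θ z + k θ * dif (I := I) h θ z := by
  have h1 : MDifferentiableAt I 𝓘(ℝ, ℝ) (fun θ => h θ * k θ) θ := hh.mul hk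
  rw [(dif_apply hθ h1 z).2, (dif_apply hθ hh z).2, (dif_apply hθ hk z).2,
    fderiv_fun_mul (dif_apply hθ hh z).1.differentiableAt (dif_apply hθ hk z).1.differentiableAt]
  simp only [add_apply, smul_apply, smul_eq_mul, extChartAt_to_inv]

theorem dif_add_smul {θ : Θ} (hθ : θ ∈ I.interior Θ) {h k : Θ → ℝ}
    (hh : MDifferentiableAt I 𝓘(ℝ, ℝ) h θ) (hk : MDifferentiableAt I 𝓘(ℝ, ℝ) k θ) (a b : ℝ)
    (z : TangentSpace I θ) :
    dif (I := I) (fun θ => a * h θ + b * k θ) θ z =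
      a * dif (I := I) h θ z + b * dif (I := I) k θ z := by
  have h1 : MDifferentiableAt I 𝓘(ℝ, ℝ) (fun θ => a * h θ + b * k θ) θ :=
    (mdifferentiableAt_const.mul hh).add (mdifferentiableAt_const.mul hk)
  have h2 : HasFDerivAt (fun y => a * h ((extChartAt I θ).symm y) +
      b * k ((extChartAt I θ).symm y)) _ (extChartAt I θ θ) :=
    ((dif_apply hθ hh z).1.differentiableAt.hasFDerivAt.const_mul a).add
      ((dif_apply hθ hk z).1.differentiableAt.hasFDerivAt.const_mul b)
  rw [(dif_apply hθ h1 z).2, (dif_apply hθ hh z).2, (dif_apply hθ hk z).2, h2.fderiv]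
  simp

theorem dif_sum {θ : Θ} (hθ : θ ∈ I.interior Θ) {ι : Type*} (t : Finset ι) {h : ι → Θ → ℝ}
    (hh : ∀ i, MDifferentiableAt I 𝓘(ℝ, ℝ) (h i) θ)
    (z : TangentSpace I θ) :
    dif (I := I) (fun θ => ∑ i ∈ t, h i θ) θ z = ∑ i ∈ t, dif (I := I) (h i) θ z := by
  classical
  induction t using Finset.induction_on with
  | empty => simp [dif_const]
  | insert i t hi ih =>
    have h1 : MDifferentiableAt I 𝓘(ℝ, ℝ) (fun θ => ∑ i ∈ t, h i θ) θ := by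
      clear ih hi
      induction t using Finset.induction_on with
      | empty => simpa using mdifferentiableAt_const
      | insert i t hi ih =>
        simp only [Finset.sum_insert hi]
        exact (hh i).add ih
    have h2 := dif_add_smul hθ (hh i) h1 1 1 z
    simp only [one_mul] at h2
    simp only [Finset.sum_insert hi, h2, ih]

theorem dif_comp {θ : Θ} (hθ : θ ∈ I.interior Θ) {h : Θ → ℝ} {φ : ℝ → ℝ} {φ' : ℝ}
    (hh : MDifferentiableAt I 𝓘(ℝ, ℝ) h θ) (hφ : HasDerivAt φ φ' (h θ)) (z : TangentSpace I θ) :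
    dif (I := I) (fun θ => φ (h θ)) θ z = φ' * dif (I := I) h θ z := by
  have h1 : MDifferentiableAt I 𝓘(ℝ, ℝ) (fun θ => φ (h θ)) θ :=
    hφ.differentiableAt.mdifferentiableAt.comp θ hh
  have h2 : HasDerivAt φ φ' (h ((extChartAt I θ).symm (extChartAt I θ θ))) := by
    rwa [extChartAt_to_inv]
  rw [(dif_apply hθ h1 z).2, (dif_apply hθ hh z).2]
  have h3 : HasFDerivAt (fun y => φ (h ((extChartAt I θ).symm y))) _ (extChartAt I θ θ) :=
    HasDerivAt.comp_hasFDerivAt (f := fun y => h ((extChartAt I θ).symm y)) _ h2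
      (dif_apply hθ hh z).1.differentiableAt.hasFDerivAt
  rw [h3.fderiv]
  simp

theorem continuous_dif_apply {s : Θ → ℝ} (hs : ContMDiff I 𝓘(ℝ, ℝ) 1 s) {Y : VField I Θ}
    (hY : Continuous (fun θ => (⟨θ, Y θ⟩ : TangentBundle I Θ))) :
    Continuous fun θ => dif (I := I) s θ (Y θ) := by
  have h1 := (hs.continuous_tangentMap le_rfl).comp hY
  exact continuous_snd.comp ((tangentBundleModelSpaceHomeomorph 𝓘(ℝ, ℝ)).continuous.comp h1)

end Differential

/-! ### The divergence theorem -/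

section DivergenceTheorem

variable {p : ℕ} {H : Type*} [TopologicalSpace H]
  {I : ModelWithCorners ℝ (EuclideanSpace ℝ (Fin p)) H}
  {Θ : Type*} [TopologicalSpace Θ] [ChartedSpace H Θ] [IsManifold I ∞ Θ]

theorem isFiniteMeasureOnCompacts_riemVolume [MeasurableSpace Θ] [BorelSpace Θ]
    (g : Metric I Θ) [T2Space Θ] :
    IsFiniteMeasureOnCompacts (riemVolume g) := by
  have : LocallyCompactSpace Θ := Manifold.locallyCompact_of_finiteDimensional I
  have : IsLocallyFiniteMeasure (riemVolume g) := by
    refine ⟨fun θ => ?_⟩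
    obtain ⟨K, hK, hKs, hKc⟩ :=
      local_compact_nhds (extChartAt_source_mem_nhds (I := I) θ)
    refine ⟨K, hK, ?_⟩
    have h1 : riemVolume g K = chartVolume g θ K := by
      rw [← riemVolume_restrict_source, Measure.restrict_apply hKc.measurableSet,
        inter_eq_self_of_subset_left hKs]
    rw [h1, chartVolume_apply g θ hKc.measurableSet]
    have h2 : (extChartAt I θ).symm ⁻¹' K ∩ (extChartAt I θ).target = extChartAt I θ '' K := by
      rw [(extChartAt I θ).image_eq_target_inter_inv_preimage hKs, inter_comm]
    rw [h2]
    have h3 : IsCompact (extChartAt I θ '' K) :=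
      hKc.image_of_continuousOn ((continuousOn_extChartAt θ).mono hKs)
    have h4 : extChartAt I θ '' K ⊆ (extChartAt I θ).target := by
      rw [← h2]; exact inter_subset_right
    exact (((continuousOn_sqrtDet g θ).mono h4).integrableOn_compact h3).lintegral_lt_top
  infer_instance

theorem aestronglyMeasurable_of_continuousOn_interior [MeasurableSpace Θ] [BorelSpace Θ]
    [SecondCountableTopology Θ] (g : Metric I Θ) {h : Θ → ℝ}
    (hc : ContinuousOn h (I.interior Θ)) : AEStronglyMeasurable h (riemVolume g) := by
  rw [← Measure.restrict_eq_self_of_ae_mem (ae_mem_interior g)]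
  exact hc.aestronglyMeasurable isOpen_interior_manifold.measurableSet

theorem mdifferentiableAt_of_contMDiffOn {h : Θ → ℝ}
    (hh : ContMDiffOn I 𝓘(ℝ, ℝ) 1 h (I.interior Θ)) {θ : Θ} (hθ : θ ∈ I.interior Θ) :
    MDifferentiableAt I 𝓘(ℝ, ℝ) h θ :=
  ((hh θ hθ).contMDiffAt (interior_mem_nhds hθ)).mdifferentiableAt one_ne_zero

/-- The divergence theorem for a field that is supported in a chart. -/
theorem integral_divergence_chart [MeasurableSpace Θ] [BorelSpace Θ] [T2Space Θ]
    (g : Metric I Θ) {Y : VField I Θ}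
    (hYc : Continuous (fun θ => (⟨θ, Y θ⟩ : TangentBundle I Θ)))
    (hYb : ∀ θ ∈ I.boundary Θ, Y θ = 0)
    (hYs : ContMDiffOn I I.tangent 1 (fun θ => (⟨θ, Y θ⟩ : TangentBundle I Θ)) (I.interior Θ))
    {k : Θ → ℝ} (hk : ContMDiffOn I 𝓘(ℝ, ℝ) 1 k (I.interior Θ)) {C : ℝ} (hkC : ∀ θ, |k θ| ≤ C)
    {x : Θ} {K : Set Θ} (hK : IsCompact K) (hKx : K ⊆ (extChartAt I x).source)
    (hk0 : ∀ θ ∉ K, k θ = 0)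
    (hint : Integrable (fun θ => k θ * divergence g Y θ + dif (I := I) k θ (Y θ)) (riemVolume g)) :
    ∫ θ, k θ * divergence g Y θ + dif (I := I) k θ (Y θ) ∂(riemVolume g) = 0 := by
  classical
  set F := fun θ => k θ * divergence g Y θ + dif (I := I) k θ (Y θ) with hF
  set T := interior (extChartAt I x).target with hT
  -- The coordinate expression extended by zero. It vanishes off the convex open set `interior
  -- (range I)` and off the compact set `K'`, so the Euclidean divergence theorem can be used there
  -- although the chart target itself need not be convex.
  set U : EuclideanSpace ℝ (Fin p) → EuclideanSpace ℝ (Fin p) :=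
    T.indicator fun y => k ((extChartAt I x).symm y) • coordDensity g Y x y with hU
  have hTO : T ⊆ interior (range I) := interior_mono (extChartAt_target_subset_range x)
  have hOT : ∀ y ∈ (extChartAt I x).target, y ∈ interior (range I) → y ∈ T := by
    intro y hy hy'
    rw [hT, extChartAt_target, interior_inter,
      ((chartAt H x).open_target.preimage I.continuous_symm).interior_eq]
    rw [extChartAt_target] at hy
    exact ⟨hy.1, hy'⟩
  set K' := extChartAt I x '' K with hK'
  have hK'c : IsCompact K' := hK.image_of_continuousOn ((continuousOn_extChartAt x).mono hKx)
  have hK't : K' ⊆ (extChartAt I x).target := by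
    rintro _ ⟨θ, hθ, rfl⟩
    exact (extChartAt I x).map_source (hKx hθ)
  have hU0 : ∀ y ∉ K', U y = 0 := by
    intro y hy
    by_cases hyT : y ∈ T
    · rw [hU, indicator_of_mem hyT, hk0, zero_smul]
      exact fun h => hy ⟨_, h, (extChartAt I x).right_inv (interior_subset hyT)⟩
    · rw [hU, indicator_of_notMem hyT]
  have hU0' : ∀ y ∉ K', U =ᶠ[𝓝 y] 0 := fun y hy =>
    eventually_of_mem (hK'c.isClosed.isOpen_compl.mem_nhds hy) fun z hz => hU0 z hz
  have hUT : ∀ y ∈ T, U =ᶠ[𝓝 y]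
      fun y => k ((extChartAt I x).symm y) • coordDensity g Y x y := fun y hy =>
    eventually_of_mem (isOpen_interior.mem_nhds hy) fun z hz => indicator_of_mem hz _
  have hkd : ∀ y ∈ T, ContDiffAt ℝ 1 (fun y => k ((extChartAt I x).symm y)) y := fun y hy => by
    have hi := (extChartAt_symm_mem_interior_iff (interior_subset hy)).2 hy
    exact contDiffAt_comp_extChartAt_symm (by simp) hy
      ((hk _ hi).contMDiffAt (interior_mem_nhds hi))
  have hUd : ∀ y ∈ T, ContDiffAt ℝ 1 U y := fun y hy =>
    ((hkd y hy).smul (contDiffAt_coordDensity g hy hYs)).congr_of_eventuallyEq (hUT y hy)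
  have hUcont : Continuous U := by
    rw [continuous_iff_continuousAt]
    intro y
    by_cases hyK : y ∈ K'
    swap
    · exact continuousAt_const.congr (hU0' y hyK).symm
    by_cases hyT : y ∈ T
    · exact (hUd y hyT).continuousAt
    have hyt := hK't hyK
    have hb : (extChartAt I x).symm y ∈ I.boundary Θ := by
      rw [← I.compl_interior]
      exact fun h => hyT ((extChartAt_symm_mem_interior_iff hyt).1 h)
    have hcD : ContinuousOn (coordDensity g Y x) (extChartAt I x).target :=
      (continuousOn_sqrtDet g x).smul (continuousOn_coordField hYc)
    have hD0 : coordDensity g Y x y = 0 := by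
      rw [coordDensity, coordField_eq hyt, hYb _ hb, map_zero, smul_zero]
    have hlim : Tendsto (coordDensity g Y x) (𝓝[(extChartAt I x).target] y) (𝓝 0) := by
      rw [← hD0]; exact hcD y hyt
    -- At a boundary point `k` is known only to be bounded; continuity of `U` comes from the
    -- vanishing of `Y`.
    have hlim2 : Tendsto U (𝓝[(extChartAt I x).target] y) (𝓝 0) := by
      refine squeeze_zero_norm (a := fun z => C * ‖coordDensity g Y x z‖) (fun z => ?_) ?_
      · refine (norm_indicator_le_norm_self _ _).trans ?_
        rw [norm_smul]
        exact mul_le_mul_of_nonneg_right (hkC _) (norm_nonneg _)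
      · simpa using hlim.norm.const_mul C
    have hlim3 : Tendsto U (𝓝[(extChartAt I x).targetᶜ] y) (𝓝 0) := by
      refine tendsto_const_nhds.congr' ?_
      filter_upwards [self_mem_nhdsWithin] with z hz
      exact (hU0 z fun h => hz (hK't h)).symm
    have hUy : U y = 0 := indicator_of_notMem hyT _
    rw [ContinuousAt, hUy, ← nhdsWithin_univ, ← union_compl_self (extChartAt I x).target,
      nhdsWithin_union]
    exact hlim2.sup hlim3
  -- The product rule for `k Y` in coordinates; the factor `sqrtDet` is the density of the
  -- Riemannian volume.
  have hdivT : ∀ y ∈ T, euclDiv U y = sqrtDet g x y * F ((extChartAt I x).symm y) := by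
    intro y hy
    have hi := (extChartAt_symm_mem_interior_iff (interior_subset hy)).2 hy
    rw [euclDiv_congr (hUT y hy), euclDiv_smul ((hkd y hy).differentiableAt one_ne_zero)
      ((contDiffAt_coordDensity g hy hYs).differentiableAt one_ne_zero), hF]
    simp only
    rw [divergence_eq g hYs hy, coordDensity, map_smul,
      fderiv_comp_extChartAt_symm_coordField hy (mdifferentiableAt_of_contMDiffOn hk hi)]
    have := (sqrtDet_pos g (interior_subset hy)).ne'
    field_simp
    rw [smul_eq_mul]
  have hdiv0 : ∀ y ∈ interior (range I) \ T, euclDiv U y = 0 := by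
    rintro y ⟨hy, hyT⟩
    rw [euclDiv_congr (hU0' y fun h => hyT (hOT y (hK't h) hy))]
    simp [euclDiv]
  have hintT : IntegrableOn (euclDiv U) T :=
    (integrable_chart g x hint).congr_fun (fun y hy => (hdivT y hy).symm)
      isOpen_interior.measurableSet
  have key := integral_euclDiv_eq_zero (O := interior (range I)) isOpen_interior
    (I.convex_range.interior) hUcont (HasCompactSupport.intro hK'c hU0)
    (fun y hy => indicator_of_notMem (fun h => hy (hTO h)) _)
    (fun y hy => by
      by_cases hyT : y ∈ T
      · exact (hUd y hyT).contDiffWithinAt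
      · exact (contDiffAt_const.congr_of_eventuallyEq
          (hU0' y fun h => hyT (hOT y (hK't h) hy))).contDiffWithinAt)
    (hintT.of_forall_sdiff_eq_zero isOpen_interior.measurableSet hdiv0)
  have hF0 : ∀ θ ∉ (extChartAt I x).source, F θ = 0 := by
    intro θ hθ
    have h1 : k =ᶠ[𝓝 θ] fun _ => 0 :=
      eventually_of_mem (hK.isClosed.isOpen_compl.mem_nhds fun h => hθ (hKx h))
        fun z hz => hk0 z hz
    simp only [hF]
    rw [dif_congr h1, dif_const, h1.eq_of_nhds]
    simp
  rw [integral_chart g x hint hF0, ← key,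
    setIntegral_eq_of_subset_of_forall_sdiff_eq_zero isOpen_interior.measurableSet hTO hdiv0]
  exact setIntegral_congr_fun isOpen_interior.measurableSet fun y hy => (hdivT y hy).symm

/-- The divergence theorem for the field `χ q Y`, where the cutoff `χ` has compact support and `q`
is bounded. -/
theorem integral_divergence_cutoff [MeasurableSpace Θ] [BorelSpace Θ] [T2Space Θ]
    [SecondCountableTopology Θ] (g : Metric I Θ) {Y : VField I Θ}
    (hYc : Continuous (fun θ => (⟨θ, Y θ⟩ : TangentBundle I Θ)))
    (hYb : ∀ θ ∈ I.boundary Θ, Y θ = 0)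
    (hYs : ContMDiffOn I I.tangent 1 (fun θ => (⟨θ, Y θ⟩ : TangentBundle I Θ)) (I.interior Θ))
    {q : Θ → ℝ} (hq : ContMDiffOn I 𝓘(ℝ, ℝ) 1 q (I.interior Θ)) {C : ℝ} (hqC : ∀ θ, |q θ| ≤ C)
    {χ : Θ → ℝ} (hχ : ContMDiff I 𝓘(ℝ, ℝ) 1 χ) (hχc : HasCompactSupport χ)
    (hint : Integrable (fun θ => q θ * divergence g Y θ + dif (I := I) q θ (Y θ))
      (riemVolume g)) :
    ∫ θ, χ θ * (q θ * divergence g Y θ + dif (I := I) q θ (Y θ)) ∂(riemVolume g) =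
      -∫ θ, q θ * dif (I := I) χ θ (Y θ) ∂(riemVolume g) := by
  have : LocallyCompactSpace Θ := Manifold.locallyCompact_of_finiteDimensional I
  have := isFiniteMeasureOnCompacts_riemVolume g
  have hqm := aestronglyMeasurable_of_continuousOn_interior g hq.continuousOn
  have hint1 : ∀ {s : Θ → ℝ}, ContMDiff I 𝓘(ℝ, ℝ) 1 s → HasCompactSupport s →
      Integrable (fun θ => s θ * (q θ * divergence g Y θ + dif (I := I) q θ (Y θ)))
        (riemVolume g) := by
    intro s hs hsc
    obtain ⟨D, hD⟩ := hsc.exists_bound_of_continuous hs.continuous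
    exact hint.bdd_mul hs.continuous.aestronglyMeasurable (Eventually.of_forall hD)
  have hint2 : ∀ {s : Θ → ℝ}, ContMDiff I 𝓘(ℝ, ℝ) 1 s → HasCompactSupport s →
      Integrable (fun θ => q θ * dif (I := I) s θ (Y θ)) (riemVolume g) := by
    intro s hs hsc
    have h1 : HasCompactSupport fun θ => dif (I := I) s θ (Y θ) := by
      refine HasCompactSupport.intro' hsc (isClosed_tsupport s) fun θ hθ => ?_
      rw [dif_congr (notMem_tsupport_iff_eventuallyEq.1 hθ)]
      change dif (I := I) (fun _ => (0 : ℝ)) θ (Y θ) = 0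
      rw [dif_const]
      rfl
    exact ((continuous_dif_apply hs hYc).integrable_of_hasCompactSupport h1).bdd_mul hqm
      (Eventually.of_forall hqC)
  obtain ⟨t, -, ht⟩ := hχc.elim_nhds_subcover (fun x => (extChartAt I x).source)
    fun x _ => extChartAt_source_mem_nhds x
  -- Finitely many chart domains cover the support of `χ`. The chart version is applied with `k = f
  -- i * χ * q`, and the differentials of the pieces `f i * χ` add up to that of `χ`.
  obtain ⟨f, hf⟩ := SmoothPartitionOfUnity.exists_isSubordinate I (isClosed_tsupport χ)
    (fun i : t => (extChartAt I (i : Θ)).source) (fun i => isOpen_extChartAt_source _)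
    (by
      intro θ hθ
      obtain ⟨x, hx, hθx⟩ := mem_iUnion₂.1 (ht hθ)
      exact mem_iUnion.2 ⟨⟨x, hx⟩, hθx⟩)
  have hfs : ∀ i, ContMDiff I 𝓘(ℝ, ℝ) 1 (fun θ => f i θ * χ θ) := fun i =>
    ((f i).contMDiff.of_le (by simp)).mul hχ
  have hfc : ∀ i, HasCompactSupport (fun θ => f i θ * χ θ) := fun i => hχc.mul_left
  have hsum : ∀ θ, ∑ i, f i θ * χ θ = χ θ := by
    intro θ
    by_cases hθ : θ ∈ tsupport χ
    · rw [← Finset.sum_mul, ← finsum_eq_sum_of_fintype, f.sum_eq_one hθ, one_mul]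
    · simp [image_eq_zero_of_notMem_tsupport hθ]
  have hloc : ∀ i, ∫ θ, (f i θ * χ θ) * (q θ * divergence g Y θ + dif (I := I) q θ (Y θ))
      ∂(riemVolume g) = -∫ θ, q θ * dif (I := I) (fun θ => f i θ * χ θ) θ (Y θ)
        ∂(riemVolume g) := by
    intro i
    -- The product rule is arranged so that `q * divergence g Y + dif q Y` stays together: only this
    -- sum is assumed integrable, not its terms.
    have hae : ∀ᵐ θ ∂(riemVolume g),
        (f i θ * χ θ) * q θ * divergence g Y θ +
          dif (I := I) (fun θ => (f i θ * χ θ) * q θ) θ (Y θ) =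
        (f i θ * χ θ) * (q θ * divergence g Y θ + dif (I := I) q θ (Y θ)) +
          q θ * dif (I := I) (fun θ => f i θ * χ θ) θ (Y θ) := by
      filter_upwards [ae_mem_interior g] with θ hθ
      rw [dif_mul hθ ((hfs i).mdifferentiableAt one_ne_zero)
        (mdifferentiableAt_of_contMDiffOn hq hθ)]
      ring
    have hi := (hint1 (hfs i) (hfc i)).add (hint2 (hfs i) (hfc i))
    obtain ⟨D, hD⟩ := (hfc i).exists_bound_of_continuous (hfs i).continuous
    have key := integral_divergence_chart g hYc hYb hYs
      (k := fun θ => (f i θ * χ θ) * q θ) (((hfs i).contMDiffOn).mul hq) (C := D * C)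
      (fun θ => by
        rw [abs_mul]
        exact mul_le_mul (hD θ) (hqC θ) (abs_nonneg _) ((norm_nonneg _).trans (hD θ)))
      (x := i) (K := tsupport (f i) ∩ tsupport χ) (hχc.inter_left (isClosed_tsupport _))
      (inter_subset_left.trans (hf i))
      (fun θ hθ => by
        by_cases h : θ ∈ tsupport (f i)
        · simp [image_eq_zero_of_notMem_tsupport fun h' => hθ ⟨h, h'⟩]
        · simp [image_eq_zero_of_notMem_tsupport h])
      (hi.congr (hae.mono fun θ h => h.symm))
    rw [integral_congr_ae hae, integral_add (hint1 (hfs i) (hfc i)) (hint2 (hfs i) (hfc i))] at key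
    linarith
  have e1 : ∫ θ, χ θ * (q θ * divergence g Y θ + dif (I := I) q θ (Y θ)) ∂(riemVolume g) =
      ∑ i, ∫ θ, (f i θ * χ θ) * (q θ * divergence g Y θ + dif (I := I) q θ (Y θ))
        ∂(riemVolume g) := by
    rw [← integral_finsetSum _ fun i _ => hint1 (hfs i) (hfc i)]
    refine integral_congr_ae (Eventually.of_forall fun θ => ?_)
    simp only
    rw [← Finset.sum_mul, hsum]
  have e2 : ∫ θ, q θ * dif (I := I) χ θ (Y θ) ∂(riemVolume g) =
      ∑ i, ∫ θ, q θ * dif (I := I) (fun θ => f i θ * χ θ) θ (Y θ) ∂(riemVolume g) := by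
    rw [← integral_finsetSum _ fun i _ => hint2 (hfs i) (hfc i)]
    refine integral_congr_ae ?_
    filter_upwards [ae_mem_interior g] with θ hθ
    rw [← Finset.mul_sum, ← dif_sum hθ _ fun i => (hfs i).mdifferentiableAt one_ne_zero,
      funext hsum]
  rw [e1, e2, Finset.sum_congr rfl fun i _ => hloc i, Finset.sum_neg_distrib]

end DivergenceTheorem

/-! ### Integration by parts -/

/-- A bounded truncation of the identity function. -/
def truncation (ε t : ℝ) : ℝ := t / (1 + ε * t ^ 2)

theorem abs_truncation_le {ε : ℝ} (hε : 0 ≤ ε) (t : ℝ) : |truncation ε t| ≤ |t| := by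
  have h : 1 ≤ 1 + ε * t ^ 2 := by nlinarith [mul_nonneg hε (sq_nonneg t)]
  rw [truncation, abs_div, abs_of_pos (by linarith : 0 < 1 + ε * t ^ 2)]
  exact div_le_self (abs_nonneg t) h

/-- Any bound that is uniform in `t` serves; this one, cruder than the optimal
$1/(2\sqrt\varepsilon)$, avoids square roots. -/
theorem abs_truncation_le_inv {ε : ℝ} (hε : 0 < ε) (hε1 : ε ≤ 1) (t : ℝ) :
    |truncation ε t| ≤ ε⁻¹ := by
  have h : 0 < 1 + ε * t ^ 2 := by positivity
  rw [truncation, abs_div, abs_of_pos h, div_le_iff₀ h, inv_mul_eq_div, le_div_iff₀ hε]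
  nlinarith [sq_nonneg (|t| - 1), sq_abs t, abs_nonneg t]

theorem hasDerivAt_truncation {ε : ℝ} (hε : 0 ≤ ε) (t : ℝ) :
    HasDerivAt (truncation ε) ((1 - ε * t ^ 2) / (1 + ε * t ^ 2) ^ 2) t := by
  have h : 1 + ε * t ^ 2 ≠ 0 := by
    have := mul_nonneg hε (sq_nonneg t)
    linarith
  have h1 : HasDerivAt (fun t : ℝ => 1 + ε * t ^ 2) (ε * (2 * t)) t := by
    simpa using ((hasDerivAt_pow 2 t).const_mul ε).const_add 1
  have h2 := (hasDerivAt_id t).div h1 h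
  refine h2.congr_deriv ?_
  simp only [id]
  ring

/-- The bound does not depend on `ε`, which provides a dominating function as `ε` tends to zero. -/
theorem abs_deriv_truncation_le {ε : ℝ} (hε : 0 ≤ ε) (t : ℝ) :
    |(1 - ε * t ^ 2) / (1 + ε * t ^ 2) ^ 2| ≤ 1 := by
  have h0 := mul_nonneg hε (sq_nonneg t)
  have h : 0 < (1 + ε * t ^ 2) ^ 2 := by positivity
  rw [abs_div, abs_of_pos h, div_le_one h, abs_le]
  constructor <;> nlinarith [mul_nonneg h0 h0]

theorem contDiff_truncation {ε : ℝ} (hε : 0 ≤ ε) : ContDiff ℝ 1 (truncation ε) := by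
  refine contDiff_id.div (by fun_prop) fun t => ?_
  have := mul_nonneg hε (sq_nonneg t)
  linarith

section Parts

variable {p : ℕ} {H : Type*} [TopologicalSpace H]
  {I : ModelWithCorners ℝ (EuclideanSpace ℝ (Fin p)) H}
  {Θ : Type*} [TopologicalSpace Θ] [ChartedSpace H Θ] [IsManifold I ∞ Θ]
  [MeasurableSpace Θ]

theorem mul_divρ (g : Metric I Θ) {ρ : Θ → ℝ} (hρ : IsPriorDensity g ρ) (v : VField I Θ)
    {θ : Θ} (hθ : θ ∈ I.interior Θ) :
    divergence g (fun θ => ρ θ • v θ) θ = divρ g ρ v θ * ρ θ := by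
  have := (hρ.pos θ hθ).ne'
  rw [divρ]
  field_simp

variable [T2Space Θ] [SecondCountableTopology Θ] [BorelSpace Θ]

/-- Insert the cutoffs `χ k`. The cut-off integrals converge to the full one by dominated
convergence, while each is at most `C` times the flux of `ρ v` through the cutoff, which tends to
zero. -/
theorem integral_divergence_bounded (g : Metric I Θ) {ρ : Θ → ℝ} (hρ : IsPriorDensity g ρ)
    {v : VField I Θ}
    (hv : ContMDiffOn I I.tangent 1 (fun θ => (⟨θ, v θ⟩ : TangentBundle I Θ)) (I.interior Θ))
    (hb : VanishesOnBoundary g ρ v) {q : Θ → ℝ} (hq : ContMDiffOn I 𝓘(ℝ, ℝ) 1 q (I.interior Θ))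
    {C : ℝ} (hqC : ∀ θ, |q θ| ≤ C)
    (hint : Integrable (fun θ => q θ * divergence g (fun θ => ρ θ • v θ) θ +
      dif (I := I) q θ (ρ θ • v θ)) (riemVolume g)) :
    ∫ θ, q θ * divergence g (fun θ => ρ θ • v θ) θ +
      dif (I := I) q θ (ρ θ • v θ) ∂(riemVolume g) = 0 := by
  obtain ⟨χ, hχ, hχc, hχI, hχ1, hχ0⟩ := hb.infinity
  have h1 : Tendsto (fun k => ∫ θ, χ k θ * (q θ * divergence g (fun θ => ρ θ • v θ) θ +
      dif (I := I) q θ (ρ θ • v θ)) ∂(riemVolume g)) atTop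
      (𝓝 (∫ θ, q θ * divergence g (fun θ => ρ θ • v θ) θ +
        dif (I := I) q θ (ρ θ • v θ) ∂(riemVolume g))) := by
    refine tendsto_integral_of_dominated_convergence _ (fun k => ?_) hint.norm (fun k => ?_) ?_
    · exact (hχ k).continuous.aestronglyMeasurable.mul hint.aestronglyMeasurable
    · refine Eventually.of_forall fun θ => ?_
      rw [norm_mul]
      refine mul_le_of_le_one_left (norm_nonneg _) ?_
      rw [Real.norm_eq_abs, abs_of_nonneg (hχI k θ).1]
      exact (hχI k θ).2
    · refine Eventually.of_forall fun θ => ?_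
      simpa using (hχ1 θ).mul_const _
  refine tendsto_nhds_unique h1 ?_
  -- `Θ` has a point at which to compare, since the prior has total mass one.
  have hC : 0 ≤ C := by
    by_contra h
    rcases isEmpty_or_nonempty Θ with he | ⟨⟨θ⟩⟩
    · have hn := hρ.normalized
      rw [Measure.eq_zero_of_isEmpty (riemVolume g), lintegral_zero_measure] at hn
      exact zero_ne_one hn
    · exact h ((abs_nonneg _).trans (hqC θ))
  have h2 : ∀ k, ‖∫ θ, χ k θ * (q θ * divergence g (fun θ => ρ θ • v θ) θ +
      dif (I := I) q θ (ρ θ • v θ)) ∂(riemVolume g)‖ ≤ C * (∫⁻ θ, ENNReal.ofReal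
        |dif (I := I) (χ k) θ (ρ θ • v θ)| ∂(riemVolume g)).toReal := by
    intro k
    rw [integral_divergence_cutoff g hb.continuous hb.boundary
      (contMDiffOn_smul_field hρ.smooth hv) hq hqC (hχ k) (hχc k) hint, norm_neg]
    have hm := (continuous_dif_apply (hχ k) hb.continuous).abs
    by_cases hfin : Integrable (fun θ => |dif (I := I) (χ k) θ (ρ θ • v θ)|) (riemVolume g)
    · rw [← integral_eq_lintegral_of_nonneg_ae (Eventually.of_forall fun θ => abs_nonneg _)
        hm.aestronglyMeasurable, ← integral_const_mul]
      refine norm_integral_le_of_norm_le (hfin.const_mul C) (Eventually.of_forall fun θ => ?_)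
      rw [norm_mul]
      exact mul_le_mul_of_nonneg_right (hqC θ) (abs_nonneg _)
    · exact absurd (by
        have : LocallyCompactSpace Θ := Manifold.locallyCompact_of_finiteDimensional I
        have := isFiniteMeasureOnCompacts_riemVolume g
        refine hm.integrable_of_hasCompactSupport ?_
        refine HasCompactSupport.intro' (hχc k) (isClosed_tsupport _) fun θ hθ => ?_
        have h3 : dif (I := I) (χ k) θ = 0 := by
          rw [dif_congr (notMem_tsupport_iff_eventuallyEq.1 hθ)]
          exact dif_const 0 θ
        rw [h3]
        simp) hfin
  refine squeeze_zero_norm h2 ?_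
  have h3 := (ENNReal.tendsto_toReal ENNReal.zero_ne_top).comp hχ0
  simpa using h3.const_mul C

/-- Integration by parts: `∇_a` and `-(1/ρ) ∇_a ρ` are adjoint for fields that vanish on the
boundary, whenever the integrals converge. -/
theorem integral_dif_eq_neg_integral_divρ (g : Metric I Θ) {ρ : Θ → ℝ} (hρ : IsPriorDensity g ρ)
    {v : VField I Θ}
    (hv : ContMDiffOn I I.tangent 1 (fun θ => (⟨θ, v θ⟩ : TangentBundle I Θ)) (I.interior Θ))
    (hb : VanishesOnBoundary g ρ v) {h : Θ → ℝ} (hh : ContMDiffOn I 𝓘(ℝ, ℝ) 1 h (I.interior Θ))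
    (hint1 : PriorIntegrable g ρ fun θ => h θ * divρ g ρ v θ)
    (hint2 : PriorIntegrable g ρ fun θ => dif (I := I) h θ (v θ)) :
    priorMean g ρ (fun θ => dif (I := I) h θ (v θ)) =
      -priorMean g ρ (fun θ => h θ * divρ g ρ v θ) := by
  rw [PriorIntegrable] at hint1 hint2
  have hhm := aestronglyMeasurable_of_continuousOn_interior g hh.continuousOn
  have hdm := aestronglyMeasurable_of_continuousOn_interior g
    (continuousOn_divρ g hρ.smooth hρ.pos hv)
  have hρm := aestronglyMeasurable_of_continuousOn_interior g hρ.smooth.continuousOn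
  -- `h` may be unbounded, so the bounded case is applied to `truncation ε (h θ)`. Its integrand `G
  -- ε` is dominated, uniformly in `ε`, by the two integrands assumed integrable, and tends to their
  -- sum as `ε` tends to zero.
  set G : ℝ → Θ → ℝ := fun ε θ => truncation ε (h θ) * (divρ g ρ v θ * ρ θ) +
    (1 - ε * h θ ^ 2) / (1 + ε * h θ ^ 2) ^ 2 * (dif (I := I) h θ (v θ) * ρ θ) with hG
  have hGb : ∀ ε, 0 ≤ ε → ∀ θ, ‖G ε θ‖ ≤
      ‖h θ * divρ g ρ v θ * ρ θ‖ + ‖dif (I := I) h θ (v θ) * ρ θ‖ := by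
    intro ε hε θ
    refine (norm_add_le _ _).trans (add_le_add ?_ ?_)
    · rw [mul_assoc, norm_mul, norm_mul (h θ)]
      exact mul_le_mul_of_nonneg_right (abs_truncation_le hε _) (norm_nonneg _)
    · rw [norm_mul]
      exact mul_le_of_le_one_left (norm_nonneg _) (abs_deriv_truncation_le hε _)
  have hGm : ∀ ε, 0 ≤ ε → AEStronglyMeasurable (G ε) (riemVolume g) := by
    intro ε hε
    have hc : Continuous fun t : ℝ => (1 - ε * t ^ 2) / (1 + ε * t ^ 2) ^ 2 := by
      refine Continuous.div (by fun_prop) (by fun_prop) fun t => ?_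
      have := mul_nonneg hε (sq_nonneg t)
      positivity
    exact (((contDiff_truncation hε).continuous.comp_aestronglyMeasurable hhm).mul
      (hdm.mul hρm)).add ((hc.comp_aestronglyMeasurable hhm).mul hint2.aestronglyMeasurable)
  have hGi : ∀ ε, 0 ≤ ε → Integrable (G ε) (riemVolume g) := fun ε hε =>
    (hint1.norm.add hint2.norm).mono' (hGm ε hε) (Eventually.of_forall (hGb ε hε))
  have hG0 : ∀ ε, 0 < ε → ε ≤ 1 → ∫ θ, G ε θ ∂(riemVolume g) = 0 := by
    intro ε hε hε1
    have hae : ∀ᵐ θ ∂(riemVolume g), G ε θ =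
        truncation ε (h θ) * divergence g (fun θ => ρ θ • v θ) θ +
        dif (I := I) (fun θ => truncation ε (h θ)) θ (ρ θ • v θ) := by
      filter_upwards [ae_mem_interior g] with θ hθ
      rw [mul_divρ g hρ v hθ, dif_comp hθ (mdifferentiableAt_of_contMDiffOn hh hθ)
        (hasDerivAt_truncation hε.le (h θ)), map_smul, smul_eq_mul, mul_comm (ρ θ)]
    rw [integral_congr_ae hae]
    exact integral_divergence_bounded g hρ hv hb
      ((contDiff_truncation hε.le).contMDiff.comp_contMDiffOn hh)
      (fun θ => abs_truncation_le_inv hε hε1 (h θ)) ((hGi ε hε.le).congr hae)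
  have hlim : Tendsto (fun n : ℕ => ∫ θ, G (1 / ((n : ℝ) + 1)) θ ∂(riemVolume g)) atTop
      (𝓝 (∫ θ, h θ * divρ g ρ v θ * ρ θ + dif (I := I) h θ (v θ) * ρ θ ∂(riemVolume g))) := by
    refine tendsto_integral_of_dominated_convergence _
      (fun n => hGm _ (by positivity)) (hint1.norm.add hint2.norm)
      (fun n => Eventually.of_forall (hGb _ (by positivity))) (Eventually.of_forall fun θ => ?_)
    have hc : ContinuousAt (fun ε => G ε θ) 0 := by
      simp only [hG, truncation]
      have : (1 : ℝ) + 0 * h θ ^ 2 ≠ 0 := by simp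
      fun_prop (disch := simp)
    have h0 : G 0 θ = h θ * divρ g ρ v θ * ρ θ + dif (I := I) h θ (v θ) * ρ θ := by
      simp only [hG, truncation]
      ring
    rw [← h0]
    exact hc.tendsto.comp tendsto_one_div_add_atTop_nhds_zero_nat
  have h0 : (fun n : ℕ => ∫ θ, G (1 / ((n : ℝ) + 1)) θ ∂(riemVolume g)) = fun _ => 0 := by
    funext n
    refine hG0 _ (by positivity) ?_
    rw [div_le_one (by positivity)]
    have : (0 : ℝ) ≤ n := Nat.cast_nonneg n
    linarith
  rw [h0] at hlim
  have := tendsto_nhds_unique tendsto_const_nhds hlim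
  rw [integral_add hint1 hint2] at this
  simp only [priorMean]
  linarith

end Parts

/-! ### The Fisher information -/

section Fisher

variable {p : ℕ} {H : Type*} [TopologicalSpace H]
  {I : ModelWithCorners ℝ (EuclideanSpace ℝ (Fin p)) H}
  {Θ : Type*} [TopologicalSpace Θ] [ChartedSpace H Θ]
  {X : Type*} [MeasurableSpace X] {μ : Measure X} {f : Θ → X → ℝ}

theorem fisher_comm (θ : Θ) (a b : TangentSpace I θ) :
    fisher I μ f θ a b = fisher I μ f θ b a := by
  simp only [fisher, mul_comm]

theorem fisher_smul_self (θ : Θ) (c : ℝ) (a : TangentSpace I θ) :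
    fisher I μ f θ (c • a) (c • a) = c ^ 2 * fisher I μ f θ a a := by
  rw [fisher, fisher, ← integral_const_mul]
  refine integral_congr_ae (Eventually.of_forall fun x => ?_)
  simp only [map_smul, smul_eq_mul]
  ring

variable [IsManifold I ∞ Θ]

/-- Polarization: the model assumes integrability only for squares of scores. -/
theorem integrable_score_mul (hf : IsRegularModel I μ f) {θ : Θ} (hθ : θ ∈ I.interior Θ)
    (a b : TangentSpace I θ) :
    Integrable (fun x => dif (I := I) (fun θ' => Real.log (f θ' x)) θ a *
      dif (I := I) (fun θ' => Real.log (f θ' x)) θ b * f θ x) μ := by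
  have h := (((hf.finite_information θ hθ (a + b)).sub (hf.finite_information θ hθ a)).sub
    (hf.finite_information θ hθ b)).const_mul (1 / 2)
  refine h.congr (Eventually.of_forall fun x => ?_)
  simp only [Pi.sub_apply, map_add]
  ring

theorem fisher_add_smul_left (hf : IsRegularModel I μ f) {θ : Θ} (hθ : θ ∈ I.interior Θ)
    (s t : ℝ) (a b c : TangentSpace I θ) :
    fisher I μ f θ (s • a + t • b) c = s * fisher I μ f θ a c + t * fisher I μ f θ b c := by
  simp only [fisher]
  rw [← integral_const_mul, ← integral_const_mul,
    ← integral_add ((integrable_score_mul hf hθ a c).const_mul s)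
      ((integrable_score_mul hf hθ b c).const_mul t)]
  refine integral_congr_ae (Eventually.of_forall fun x => ?_)
  simp only [map_add, map_smul, smul_eq_mul]
  ring

theorem fisher_add_smul_right (hf : IsRegularModel I μ f) {θ : Θ} (hθ : θ ∈ I.interior Θ)
    (s t : ℝ) (a b c : TangentSpace I θ) :
    fisher I μ f θ c (s • a + t • b) = s * fisher I μ f θ c a + t * fisher I μ f θ c b := by
  rw [fisher_comm, fisher_add_smul_left hf hθ, fisher_comm θ a, fisher_comm θ b]

theorem fisher_self_nonneg (hf : IsRegularModel I μ f) (θ : Θ) (a : TangentSpace I θ) :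
    0 ≤ fisher I μ f θ a a :=
  integral_nonneg fun x => mul_nonneg (mul_self_nonneg _) (hf.nonneg θ x)

theorem fisher_add_smul_self (hf : IsRegularModel I μ f) {θ : Θ} (hθ : θ ∈ I.interior Θ)
    (t : ℝ) (a b : TangentSpace I θ) :
    fisher I μ f θ (a + t • b) (a + t • b) =
      fisher I μ f θ a a + 2 * t * fisher I μ f θ a b + t ^ 2 * fisher I μ f θ b b := by
  have h1 := fisher_add_smul_left hf hθ 1 t a b (a + t • b)
  have h2 := fisher_add_smul_right hf hθ 1 t a b a
  have h3 := fisher_add_smul_right hf hθ 1 t a b b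
  simp only [one_smul, one_mul] at h1 h2 h3
  rw [h1, h2, h3, fisher_comm θ b a]
  ring

/-- Positivity on `a + b` and `a - b`. The bound is weaker than Cauchy-Schwarz, but additive, which
is what domination of the mixed term requires. -/
theorem abs_fisher_le (hf : IsRegularModel I μ f) {θ : Θ} (hθ : θ ∈ I.interior Θ)
    (a b : TangentSpace I θ) :
    |fisher I μ f θ a b| ≤ fisher I μ f θ a a + fisher I μ f θ b b := by
  have h1 := fisher_self_nonneg hf θ (a + (1 : ℝ) • b)
  have h2 := fisher_self_nonneg hf θ (a + (-1 : ℝ) • b)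
  have h3 := fisher_self_nonneg hf θ a
  have h4 := fisher_self_nonneg hf θ b
  rw [fisher_add_smul_self hf hθ] at h1 h2
  rw [abs_le]
  constructor <;> linarith

/-- A zero integral of the squared score means that at almost every sample point the score along `b`
or the density vanishes, and then so does every mixed integrand. -/
theorem fisher_eq_zero_of_self (hf : IsRegularModel I μ f) {θ : Θ} (hθ : θ ∈ I.interior Θ)
    {b : TangentSpace I θ} (hb : fisher I μ f θ b b = 0) (a : TangentSpace I θ) :
    fisher I μ f θ a b = 0 := by
  have h1 := (integral_eq_zero_iff_of_nonneg (fun x => mul_nonneg (mul_self_nonneg _)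
    (hf.nonneg θ x)) (integrable_score_mul hf hθ b b)).1 hb
  refine integral_eq_zero_of_ae ?_
  filter_upwards [h1] with x hx
  simp only [Pi.zero_apply, mul_eq_zero, or_self] at hx ⊢
  tauto

theorem continuousOn_fisher (hf : IsRegularModel I μ f) {v w : VField I Θ}
    (hv : ContMDiffOn I I.tangent 1 (fun θ => (⟨θ, v θ⟩ : TangentBundle I Θ)) (I.interior Θ))
    (hw : ContMDiffOn I I.tangent 1 (fun θ => (⟨θ, w θ⟩ : TangentBundle I Θ)) (I.interior Θ)) :
    ContinuousOn (fun θ => fisher I μ f θ (v θ) (w θ)) (I.interior Θ) := by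
  have h1 := hf.continuous_information v hv.continuousOn
  have h2 := hf.continuous_information w hw.continuousOn
  have h3 := hf.continuous_information _ (contMDiffOn_add_smul 1 1 hv hw).continuousOn
  refine (((h3.sub h1).sub h2).mul (continuousOn_const (c := (1 / 2 : ℝ)))).congr fun θ hθ => ?_
  have := fisher_add_smul_self hf hθ 1 (v θ) (w θ)
  simp only [Pi.sub_apply, Pi.mul_apply, one_smul] at this ⊢
  rw [this]
  ring

/-- The density of the quadratic form at the field `v + t w`. -/
def formDensity (μ : Measure X) (f : Θ → X → ℝ) (n : ℕ) (g : Metric I Θ) (ρ : Θ → ℝ)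
    (v w : VField I Θ) (t : ℝ) (θ : Θ) : ℝ :=
  n * fisher I μ f θ (v θ + t • w θ) (v θ + t • w θ) + (divρ g ρ v θ + t * divρ g ρ w θ) ^ 2

theorem formDensity_nonneg {g : Metric I Θ} {ρ : Θ → ℝ} (hf : IsRegularModel I μ f)
    (n : ℕ) (v w : VField I Θ) (t : ℝ) (θ : Θ) : 0 ≤ formDensity μ f n g ρ v w t θ :=
  add_nonneg (mul_nonneg n.cast_nonneg (fisher_self_nonneg hf θ _)) (sq_nonneg _)

end Fisher

/-! ### The quadratic form of the Gill-Levit bound -/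

section Form

variable {p : ℕ} {H : Type*} [TopologicalSpace H]
  {I : ModelWithCorners ℝ (EuclideanSpace ℝ (Fin p)) H}
  {Θ : Type*} [TopologicalSpace Θ] [ChartedSpace H Θ] [IsManifold I ∞ Θ] [MeasurableSpace Θ]
  {X : Type*} [MeasurableSpace X]

/-- The symmetric bilinear form whose quadratic form is the denominator of the bound. -/
def form (μ : Measure X) (f : Θ → X → ℝ) (n : ℕ) (g : Metric I Θ) (ρ : Θ → ℝ)
    (v w : VField I Θ) : ℝ :=
  n * priorMean g ρ (fun θ => fisher I μ f θ (v θ) (w θ)) +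
    priorMean g ρ (fun θ => divρ g ρ v θ * divρ g ρ w θ)

theorem priorMean_add_smul {g : Metric I Θ} {ρ h k : Θ → ℝ} (hh : PriorIntegrable g ρ h)
    (hk : PriorIntegrable g ρ k) (a b : ℝ) :
    PriorIntegrable g ρ (fun θ => a * h θ + b * k θ) ∧
    priorMean g ρ (fun θ => a * h θ + b * k θ) = a * priorMean g ρ h + b * priorMean g ρ k := by
  have e : ∀ θ, (a * h θ + b * k θ) * ρ θ = a * (h θ * ρ θ) + b * (k θ * ρ θ) := fun θ => by ring
  simp only [PriorIntegrable, priorMean, e]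
  refine ⟨(hh.const_mul a).add (hk.const_mul b), ?_⟩
  rw [integral_add (Integrable.const_mul hh a) (Integrable.const_mul hk b), integral_const_mul,
    integral_const_mul]

theorem denom_eq_form (μ : Measure X) (f : Θ → X → ℝ) (n : ℕ) (g : Metric I Θ) (ρ : Θ → ℝ)
    (v : VField I Θ) : denom μ f n g ρ v = form μ f n g ρ v v := by
  simp only [denom, form, sq]

theorem form_comm (μ : Measure X) (f : Θ → X → ℝ) (n : ℕ) (g : Metric I Θ) (ρ : Θ → ℝ)
    (v w : VField I Θ) : form μ f n g ρ v w = form μ f n g ρ w v := by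
  simp only [form, mul_comm (divρ g ρ v _), fisher_comm _ (v _)]

theorem form_self_nonneg {μ : Measure X} {f : Θ → X → ℝ} {g : Metric I Θ} {ρ : Θ → ℝ}
    (hf : IsRegularModel I μ f) (hρ : IsPriorDensity g ρ) (n : ℕ)
    (v : VField I Θ) : 0 ≤ form μ f n g ρ v v :=
  add_nonneg
    (mul_nonneg n.cast_nonneg (integral_nonneg fun θ =>
      mul_nonneg (fisher_self_nonneg hf θ _) (hρ.nonneg θ)))
    (integral_nonneg fun θ => mul_nonneg (mul_self_nonneg _) (hρ.nonneg θ))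

variable [SecondCountableTopology Θ] [BorelSpace Θ]

theorem priorMean_congr {g : Metric I Θ} {ρ h k : Θ → ℝ} (e : ∀ θ ∈ I.interior Θ, h θ = k θ) :
    (PriorIntegrable g ρ h ↔ PriorIntegrable g ρ k) ∧ priorMean g ρ h = priorMean g ρ k := by
  have hae : (fun θ => h θ * ρ θ) =ᵐ[riemVolume g] fun θ => k θ * ρ θ := by
    filter_upwards [ae_mem_interior g] with θ hθ
    rw [e θ hθ]
  exact ⟨integrable_congr hae, integral_congr_ae hae⟩

variable {μ : Measure X} {f : Θ → X → ℝ} {g : Metric I Θ} {ρ : Θ → ℝ}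

theorem priorIntegrable_fisher (hf : IsRegularModel I μ f) (hρ : IsPriorDensity g ρ)
    {v w : VField I Θ} (hv : IsField μ f g ρ v) (hw : IsField μ f g ρ w) :
    PriorIntegrable g ρ (fun θ => fisher I μ f θ (v θ) (w θ)) := by
  refine (hv.finite_F.add hw.finite_F).mono' ?_ ?_
  · exact aestronglyMeasurable_of_continuousOn_interior g
      ((continuousOn_fisher hf hv.smooth hw.smooth).mul hρ.smooth.continuousOn)
  · filter_upwards [ae_mem_interior g] with θ hθ
    rw [norm_mul, Real.norm_eq_abs, Real.norm_eq_abs, abs_of_pos (hρ.pos θ hθ), Pi.add_apply,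
      ← add_mul]
    exact mul_le_mul_of_nonneg_right (abs_fisher_le hf hθ _ _) (hρ.nonneg θ)

theorem priorIntegrable_divρ_mul (hρ : IsPriorDensity g ρ)
    {v w : VField I Θ} (hv : IsField μ f g ρ v) (hw : IsField μ f g ρ w) :
    PriorIntegrable g ρ (fun θ => divρ g ρ v θ * divρ g ρ w θ) := by
  refine (hv.finite_P.add hw.finite_P).mono' ?_ ?_
  · exact aestronglyMeasurable_of_continuousOn_interior g
      (((continuousOn_divρ g hρ.smooth hρ.pos hv.smooth).mul
        (continuousOn_divρ g hρ.smooth hρ.pos hw.smooth)).mul hρ.smooth.continuousOn)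
  · refine Eventually.of_forall fun θ => ?_
    rw [norm_mul, Real.norm_eq_abs, Real.norm_eq_abs, abs_of_nonneg (hρ.nonneg θ), Pi.add_apply,
      ← add_mul]
    refine mul_le_mul_of_nonneg_right ?_ (hρ.nonneg θ)
    rw [abs_le]
    constructor <;> nlinarith [sq_nonneg (divρ g ρ v θ + divρ g ρ w θ),
      sq_nonneg (divρ g ρ v θ - divρ g ρ w θ), sq_nonneg (divρ g ρ v θ), sq_nonneg (divρ g ρ w θ)]

/-- Two admissible fields may come with different cutoffs at infinity, so `v + t w` is not evidently
admissible. Working with the density alone gives the quadratic polynomial in `t` without that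
closure property. -/
theorem priorMean_formDensity (hf : IsRegularModel I μ f) (hρ : IsPriorDensity g ρ) (n : ℕ)
    {v w : VField I Θ} (hv : IsField μ f g ρ v) (hw : IsField μ f g ρ w) (t : ℝ) :
    PriorIntegrable g ρ (formDensity μ f n g ρ v w t) ∧
    priorMean g ρ (formDensity μ f n g ρ v w t) =
      form μ f n g ρ v v + 2 * t * form μ f n g ρ v w + t ^ 2 * form μ f n g ρ w w := by
  have hF : ∀ {v w : VField I Θ}, IsField μ f g ρ v → IsField μ f g ρ w →
      PriorIntegrable g ρ (fun θ => n * fisher I μ f θ (v θ) (w θ) +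
        1 * (divρ g ρ v θ * divρ g ρ w θ)) ∧
      priorMean g ρ (fun θ => n * fisher I μ f θ (v θ) (w θ) +
        1 * (divρ g ρ v θ * divρ g ρ w θ)) = form μ f n g ρ v w := fun hv hw => by
    have := priorMean_add_smul (priorIntegrable_fisher hf hρ hv hw)
      (priorIntegrable_divρ_mul hρ hv hw) n 1
    exact ⟨this.1, this.2.trans (by rw [form, one_mul])⟩
  have h1 := priorMean_add_smul (hF hv hv).1 (hF hv hw).1 1 (2 * t)
  have h2 := priorMean_add_smul h1.1 (hF hw hw).1 1 (t ^ 2)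
  have e := priorMean_congr (g := g) (ρ := ρ) (h := formDensity μ f n g ρ v w t)
    (k := fun θ => 1 * (1 * (n * fisher I μ f θ (v θ) (v θ) +
        1 * (divρ g ρ v θ * divρ g ρ v θ)) + 2 * t * (n * fisher I μ f θ (v θ) (w θ) +
        1 * (divρ g ρ v θ * divρ g ρ w θ))) + t ^ 2 * (n * fisher I μ f θ (w θ) (w θ) +
        1 * (divρ g ρ w θ * divρ g ρ w θ)))
    (fun θ hθ => by
      rw [formDensity, fisher_add_smul_self hf hθ]
      ring)
  refine ⟨e.1.2 h2.1, ?_⟩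
  rw [e.2, h2.2, h1.2, (hF hv hv).2, (hF hv hw).2, (hF hw hw).2]
  ring

/-- A nonnegative continuous density with zero integral vanishes on the interior, where `ρ` is
positive; both of its summands are nonnegative, so each vanishes. -/
theorem formDensity_eq_zero (hf : IsRegularModel I μ f) (hρ : IsPriorDensity g ρ) (n : ℕ)
    {v w : VField I Θ} (hv : IsField μ f g ρ v) (hw : IsField μ f g ρ w) {t : ℝ}
    (h0 : form μ f n g ρ v v + 2 * t * form μ f n g ρ v w + t ^ 2 * form μ f n g ρ w w = 0)
    {θ : Θ} (hθ : θ ∈ I.interior Θ) :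
    n * fisher I μ f θ (v θ + t • w θ) (v θ + t • w θ) = 0 ∧
      divρ g ρ v θ + t * divρ g ρ w θ = 0 := by
  obtain ⟨hi, hm⟩ := priorMean_formDensity hf hρ n hv hw t
  rw [h0, priorMean, integral_eq_zero_iff_of_nonneg
    (fun θ => mul_nonneg (formDensity_nonneg hf n v w t θ) (hρ.nonneg θ)) hi] at hm
  have hs : ContMDiffOn I I.tangent 1 (fun θ => (⟨θ, v θ + t • w θ⟩ : TangentBundle I Θ))
      (I.interior Θ) := by
    have := contMDiffOn_add_smul 1 t hv.smooth hw.smooth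
    simpa only [one_smul] using this
  have hc : ContinuousOn (fun θ => formDensity μ f n g ρ v w t θ * ρ θ) (I.interior Θ) := by
    refine ContinuousOn.mul ?_ hρ.smooth.continuousOn
    exact (continuousOn_const.mul (continuousOn_fisher hf hs hs)).add
      (((continuousOn_divρ g hρ.smooth hρ.pos hv.smooth).add (continuousOn_const.mul
        (continuousOn_divρ g hρ.smooth hρ.pos hw.smooth))).pow 2)
  have h1 := eq_zero_on_interior_of_ae g hc hm θ hθ
  have h2 : formDensity μ f n g ρ v w t θ = 0 :=
    (mul_eq_zero.1 h1).resolve_right (hρ.pos θ hθ).ne'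
  have h3 := mul_nonneg n.cast_nonneg (fisher_self_nonneg hf θ (v θ + t • w θ)) (α := ℝ)
  have h4 := sq_nonneg (divρ g ρ v θ + t * divρ g ρ w θ)
  rw [formDensity] at h2
  exact ⟨by linarith, pow_eq_zero_iff two_ne_zero |>.1 (by linarith)⟩

/-- The Cauchy-Schwarz inequality. -/
theorem form_sq_le (hf : IsRegularModel I μ f) (hρ : IsPriorDensity g ρ) (n : ℕ)
    {v w : VField I Θ} (hv : IsField μ f g ρ v) (hw : IsField μ f g ρ w) :
    form μ f n g ρ v w ^ 2 ≤ form μ f n g ρ w w * form μ f n g ρ v v := by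
  -- The quadratic polynomial in `t` is nonnegative for all real `t`.
  have h := discrim_le_zero (a := form μ f n g ρ w w) (b := 2 * form μ f n g ρ v w)
    (c := form μ f n g ρ v v) fun t => by
      have h1 := (priorMean_formDensity hf hρ n hv hw t).2
      have h2 : 0 ≤ priorMean g ρ (formDensity μ f n g ρ v w t) := integral_nonneg fun θ =>
        mul_nonneg (formDensity_nonneg hf n v w t θ) (hρ.nonneg θ)
      nlinarith
  rw [discrim] at h
  nlinarith

variable [T2Space Θ]

/-- Integration by parts of `divρ g ρ w` against `v`. The differential term is integrable because it
is the difference of the Fisher term and the given integrand. -/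
theorem priorMean_opL (hf : IsRegularModel I μ f) (hρ : IsPriorDensity g ρ) (n : ℕ)
    {v w : VField I Θ} (hv : IsField μ f g ρ v) (hw : IsField μ f g ρ w) (hwL : LDiff g ρ w)
    (hi : PriorIntegrable g ρ (fun θ => opL μ f n g ρ w θ (v θ))) :
    priorMean g ρ (fun θ => opL μ f n g ρ w θ (v θ)) = form μ f n g ρ v w := by
  have hF := priorIntegrable_fisher hf hρ hv hw
  have h1 := priorMean_add_smul hF hi n (-1)
  have e : (fun θ => n * fisher I μ f θ (v θ) (w θ) + (-1) * opL μ f n g ρ w θ (v θ)) =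
      fun θ => dif (I := I) (divρ g ρ w) θ (v θ) := by
    funext θ
    rw [opL]
    ring
  rw [e] at h1
  have h2 := integral_dif_eq_neg_integral_divρ g hρ hv.smooth hv.vanishes hwL.smooth_div
    (priorIntegrable_divρ_mul hρ hw hv) h1.1
  rw [h1.2] at h2
  simp only [mul_comm (divρ g ρ w _)] at h2
  rw [form]
  linarith

end Form

/-! ### Linearity of `L` -/

section Linear

variable {p : ℕ} {H : Type*} [TopologicalSpace H]
  {I : ModelWithCorners ℝ (EuclideanSpace ℝ (Fin p)) H}
  {Θ : Type*} [TopologicalSpace Θ] [ChartedSpace H Θ] [IsManifold I ∞ Θ]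
  {X : Type*} [MeasurableSpace X] {μ : Measure X} {f : Θ → X → ℝ}
  {g : Metric I Θ} {ρ : Θ → ℝ}

theorem LDiff.add_smul (hρ : ContMDiffOn I 𝓘(ℝ, ℝ) 1 ρ (I.interior Θ)) {v w : VField I Θ}
    (hv : LDiff g ρ v) (hw : LDiff g ρ w) (a b : ℝ) :
    LDiff g ρ (fun θ => a • v θ + b • w θ) := by
  refine ⟨contMDiffOn_add_smul a b hv.smooth hw.smooth, ?_⟩
  have h : ContMDiffOn I 𝓘(ℝ, ℝ) 1 (fun θ => a * divρ g ρ v θ + b * divρ g ρ w θ)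
      (I.interior Θ) :=
    (contMDiffOn_const.mul hv.smooth_div).add (contMDiffOn_const.mul hw.smooth_div)
  exact h.congr fun θ hθ => divρ_add_smul g hρ a b hv.smooth hw.smooth hθ

theorem opL_add_smul (hf : IsRegularModel I μ f) (n : ℕ)
    (hρ : ContMDiffOn I 𝓘(ℝ, ℝ) 1 ρ (I.interior Θ)) {v w : VField I Θ}
    (hv : LDiff g ρ v) (hw : LDiff g ρ w) (a b : ℝ) {θ : Θ} (hθ : θ ∈ I.interior Θ)
    (z : TangentSpace I θ) :
    opL μ f n g ρ (fun θ => a • v θ + b • w θ) θ z =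
      a * opL μ f n g ρ v θ z + b * opL μ f n g ρ w θ z := by
  have e : divρ g ρ (fun θ => a • v θ + b • w θ) =ᶠ[𝓝 θ]
      fun θ => a * divρ g ρ v θ + b * divρ g ρ w θ := by
    filter_upwards [interior_mem_nhds hθ] with θ' hθ'
    exact divρ_add_smul g hρ a b hv.smooth hw.smooth hθ'
  rw [opL, dif_congr e, dif_add_smul hθ (mdifferentiableAt_of_contMDiffOn hv.smooth_div hθ)
    (mdifferentiableAt_of_contMDiffOn hw.smooth_div hθ), fisher_add_smul_right hf hθ, opL, opL]
  ring

/-- Says that the values of `L` are covectors. -/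
theorem opL_apply_smul_add (hf : IsRegularModel I μ f) (n : ℕ) (v : VField I Θ) (a : ℝ)
    {θ : Θ} (hθ : θ ∈ I.interior Θ) (z z' : TangentSpace I θ) :
    opL μ f n g ρ v θ (a • z + z') = a * opL μ f n g ρ v θ z + opL μ f n g ρ v θ z' := by
  have h := fisher_add_smul_left hf hθ a 1 z z' (v θ)
  rw [one_smul, one_mul] at h
  rw [opL, h, map_add, map_smul, smul_eq_mul, opL, opL]
  ring

theorem divρ_smul (hρ : ContMDiffOn I 𝓘(ℝ, ℝ) 1 ρ (I.interior Θ)) {v : VField I Θ}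
    (hv : ContMDiffOn I I.tangent 1 (fun θ => (⟨θ, v θ⟩ : TangentBundle I Θ)) (I.interior Θ))
    (c : ℝ) {θ : Θ} (hθ : θ ∈ I.interior Θ) :
    divρ g ρ (fun θ => c • v θ) θ = c * divρ g ρ v θ := by
  simpa using divρ_add_smul g hρ c 0 hv hv hθ

variable [MeasurableSpace Θ]

theorem VanishesOnBoundary.smul {v : VField I Θ} (hv : VanishesOnBoundary g ρ v) (c : ℝ) :
    VanishesOnBoundary g ρ (fun θ => c • v θ) := by
  have e : ∀ θ, ρ θ • c • v θ = c • ρ θ • v θ := fun θ => smul_comm _ _ _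
  refine ⟨?_, fun θ hθ => by rw [e, hv.boundary θ hθ, smul_zero], ?_⟩
  · have h : ContMDiff I I.tangent 0 (fun θ => (⟨θ, ρ θ • v θ⟩ : TangentBundle I Θ)) :=
      contMDiff_zero_iff.2 hv.continuous
    simp only [e]
    exact (h.const_smul_section (a := c)).continuous
  · obtain ⟨χ, h1, h2, h3, h4, h5⟩ := hv.infinity
    refine ⟨χ, h1, h2, h3, h4, ?_⟩
    have h6 := ENNReal.Tendsto.const_mul (a := ENNReal.ofReal |c|) h5
      (Or.inr ENNReal.ofReal_ne_top)
    rw [mul_zero] at h6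
    refine h6.congr fun k => ?_
    rw [← lintegral_const_mul' _ _ ENNReal.ofReal_ne_top]
    refine lintegral_congr fun θ => ?_
    rw [e, (dif (χ k) θ).map_smul c, smul_eq_mul, abs_mul, ENNReal.ofReal_mul (abs_nonneg c)]

variable [SecondCountableTopology Θ] [BorelSpace Θ]

theorem IsField.smul (hρ : IsPriorDensity g ρ) {v : VField I Θ}
    (hv : IsField μ f g ρ v) (c : ℝ) : IsField μ f g ρ (fun θ => c • v θ) := by
  refine ⟨by simpa using contMDiffOn_add_smul c 0 hv.smooth hv.smooth, hv.vanishes.smul c, ?_, ?_⟩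
  · refine (Integrable.const_mul hv.finite_F (c ^ 2)).congr (Eventually.of_forall fun θ => ?_)
    simp only [fisher_smul_self]
    ring
  · refine (Integrable.const_mul hv.finite_P (c ^ 2)).congr ?_
    filter_upwards [ae_mem_interior g] with θ hθ
    rw [divρ_smul hρ.smooth hv.smooth c hθ]
    ring

theorem denom_smul (hρ : IsPriorDensity g ρ) (n : ℕ) {v : VField I Θ}
    (hv : IsField μ f g ρ v) (c : ℝ) :
    denom μ f n g ρ (fun θ => c • v θ) = c ^ 2 * denom μ f n g ρ v := by
  have h1 : priorMean g ρ (fun θ => divρ g ρ (fun θ => c • v θ) θ ^ 2) =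
      c ^ 2 * priorMean g ρ (fun θ => divρ g ρ v θ ^ 2) := by
    rw [(priorMean_congr fun θ hθ => by rw [divρ_smul hρ.smooth hv.smooth c hθ, mul_pow]).2,
      priorMean, priorMean, ← integral_const_mul]
    simp only [mul_assoc]
  have h2 : priorMean g ρ (fun θ => fisher I μ f θ (c • v θ) (c • v θ)) =
      c ^ 2 * priorMean g ρ (fun θ => fisher I μ f θ (v θ) (v θ)) := by
    simp only [priorMean, ← integral_const_mul, fisher_smul_self, mul_assoc]
  rw [denom, denom, h1, h2]
  ring

end Linear

/-! ### The maximum of the bound -/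

section Maximum

variable {p : ℕ} {H : Type*} [TopologicalSpace H]
  {I : ModelWithCorners ℝ (EuclideanSpace ℝ (Fin p)) H}
  {Θ : Type*} [TopologicalSpace Θ] [ChartedSpace H Θ] [IsManifold I ∞ Θ] [MeasurableSpace Θ]
  {X : Type*} [MeasurableSpace X] {μ : Measure X} {f : Θ → X → ℝ} {n : ℕ}
  {g : Metric I Θ} {ρ : Θ → ℝ} {u : CField I Θ}

theorem InFamily.form_pos (hf : IsRegularModel I μ f) (hρ : IsPriorDensity g ρ)
    {v : VField I Θ} (hv : InFamily μ f n g ρ u v) : 0 < form μ f n g ρ v v :=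
  lt_of_le_of_ne (form_self_nonneg hf hρ n v) (denom_eq_form μ f n g ρ v ▸ hv.denom_ne.symm)

theorem priorMean_apply_smul (g : Metric I Θ) (ρ : Θ → ℝ) (u : CField I Θ) (v : VField I Θ)
    (c : ℝ) :
    priorMean g ρ (fun θ => u θ (c • v θ)) = c * priorMean g ρ (fun θ => u θ (v θ)) := by
  simp only [priorMean, ← integral_const_mul, map_smul, smul_eq_mul, mul_assoc]

theorem priorIntegrable_apply_smul {v : VField I Θ}
    (h : PriorIntegrable g ρ (fun θ => u θ (v θ))) (c : ℝ) :
    PriorIntegrable g ρ (fun θ => u θ (c • v θ)) := by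
  have := Integrable.const_mul h c
  simpa only [PriorIntegrable, map_smul, smul_eq_mul, mul_assoc] using this

variable [SecondCountableTopology Θ] [BorelSpace Θ]

theorem InFamily.smul (hρ : IsPriorDensity g ρ) {v : VField I Θ}
    (hv : InFamily μ f n g ρ u v) {c : ℝ} (hc : c ≠ 0) :
    InFamily μ f n g ρ u (fun θ => c • v θ) := by
  refine ⟨hv.isField.smul hρ c, priorIntegrable_apply_smul hv.finite_A c, ?_⟩
  rw [denom_smul hρ n hv.isField]
  exact mul_ne_zero (pow_ne_zero 2 hc) hv.denom_ne

theorem bound_smul (hρ : IsPriorDensity g ρ) {v : VField I Θ}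
    (hv : IsField μ f g ρ v) (u : CField I Θ) {c : ℝ} (hc : c ≠ 0) :
    bound μ f n g ρ u (fun θ => c • v θ) = bound μ f n g ρ u v := by
  rw [bound, denom_smul hρ n hv, priorMean_apply_smul, mul_pow,
    mul_div_mul_left _ _ (pow_ne_zero 2 hc), bound]

/-- If the form vanished at `w`, then `divρ g ρ w` and `n` times the Fisher pairing with `w` would
be zero on the interior. Hence `L w = u` would vanish there, contrary to `hu`. -/
theorem denom_ne_zero_of_isLInv (hf : IsRegularModel I μ f) (hρ : IsPriorDensity g ρ)
    {w : VField I Θ} (hw : IsLInv μ f n g ρ u w) (hu : ∃ θ ∈ I.interior Θ, u θ ≠ 0) :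
    denom μ f n g ρ w ≠ 0 := by
  intro h0
  rw [denom_eq_form] at h0
  obtain ⟨θ, hθ, hne⟩ := hu
  have key := fun θ (hθ : θ ∈ I.interior Θ) =>
    formDensity_eq_zero hf hρ n hw.isField hw.isField (t := 0) (by simpa using h0) hθ
  refine hne (ContinuousLinearMap.ext fun z => ?_)
  have e : divρ g ρ w =ᶠ[𝓝 θ] fun _ => 0 := by
    filter_upwards [interior_mem_nhds hθ] with θ' hθ'
    simpa using (key θ' hθ').2
  have hF : n * fisher I μ f θ z (w θ) = 0 := by
    have h1 := (key θ hθ).1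
    rw [zero_smul, add_zero, mul_eq_zero] at h1
    rcases h1 with h1 | h1
    · rw [h1, zero_mul]
    · rw [fisher_eq_zero_of_self hf hθ h1, mul_zero]
  rw [← hw.eq θ hθ z, opL, hF, dif_congr e, dif_const]
  simp

theorem IsLInv.inFamily (hf : IsRegularModel I μ f) (hρ : IsPriorDensity g ρ)
    {w : VField I Θ} (hw : IsLInv μ f n g ρ u w) (hu : ∃ θ ∈ I.interior Θ, u θ ≠ 0) :
    InFamily μ f n g ρ u w :=
  ⟨hw.isField, hw.finite_A, denom_ne_zero_of_isLInv hf hρ hw hu⟩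

variable [T2Space Θ]

/-- The Riesz-type representation behind the theorem: `w` represents the numerator functional with
respect to `form`. -/
theorem priorMean_apply_eq_form (hf : IsRegularModel I μ f) (hρ : IsPriorDensity g ρ)
    {v w : VField I Θ} (hw : IsLInv μ f n g ρ u w) (hv : IsField μ f g ρ v)
    (hi : PriorIntegrable g ρ (fun θ => u θ (v θ))) :
    priorMean g ρ (fun θ => u θ (v θ)) = form μ f n g ρ v w := by
  have e := priorMean_congr (g := g) (ρ := ρ) (h := fun θ => opL μ f n g ρ w θ (v θ))
    (k := fun θ => u θ (v θ)) fun θ hθ => hw.eq θ hθ (v θ)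
  rw [← e.2, priorMean_opL hf hρ n hv hw.isField hw.ldiff (e.1.2 hi)]

theorem bound_eq_form_div (hf : IsRegularModel I μ f) (hρ : IsPriorDensity g ρ)
    {v w : VField I Θ} (hw : IsLInv μ f n g ρ u w) (hv : InFamily μ f n g ρ u v) :
    bound μ f n g ρ u v = form μ f n g ρ v w ^ 2 / form μ f n g ρ v v := by
  rw [bound, priorMean_apply_eq_form hf hρ hw hv.isField hv.finite_A, denom_eq_form]

theorem bound_eq_form_self (hf : IsRegularModel I μ f) (hρ : IsPriorDensity g ρ)
    {w : VField I Θ} (hw : IsLInv μ f n g ρ u w) (hu : ∃ θ ∈ I.interior Θ, u θ ≠ 0) :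
    bound μ f n g ρ u w = form μ f n g ρ w w := by
  rw [bound_eq_form_div hf hρ hw (hw.inFamily hf hρ hu), sq,
    mul_div_cancel_right₀ _ ((hw.inFamily hf hρ hu).form_pos hf hρ).ne']

theorem bound_le_bound (hf : IsRegularModel I μ f) (hρ : IsPriorDensity g ρ)
    {v w : VField I Θ} (hw : IsLInv μ f n g ρ u w) (hu : ∃ θ ∈ I.interior Θ, u θ ≠ 0)
    (hv : InFamily μ f n g ρ u v) : bound μ f n g ρ u v ≤ bound μ f n g ρ u w := by
  rw [bound_eq_form_self hf hρ hw hu, bound_eq_form_div hf hρ hw hv,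
    div_le_iff₀ (hv.form_pos hf hρ)]
  exact form_sq_le hf hρ n hv.isField hw.isField

theorem isGreatest_bound (hf : IsRegularModel I μ f) (hρ : IsPriorDensity g ρ)
    {w : VField I Θ} (hw : IsLInv μ f n g ρ u w) (hu : ∃ θ ∈ I.interior Θ, u θ ≠ 0) :
    IsGreatest (bound μ f n g ρ u '' {v | InFamily μ f n g ρ u v}) (innerρ g ρ w u) := by
  rw [innerρ, priorMean_apply_eq_form hf hρ hw hw.isField hw.finite_A,
    ← bound_eq_form_self hf hρ hw hu]
  refine ⟨mem_image_of_mem _ (hw.inFamily hf hρ hu), ?_⟩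
  rintro _ ⟨v, hv, rfl⟩
  exact bound_le_bound hf hρ hw hu hv

/-- A field that attains the maximum is a multiple of a preimage of `u` under `L`. -/
theorem exists_isLInv_of_bound_eq (hf : IsRegularModel I μ f) (hρ : IsPriorDensity g ρ)
    {v w : VField I Θ} (hw : IsLInv μ f n g ρ u w) (hu : ∃ θ ∈ I.interior Θ, u θ ≠ 0)
    (hv : InFamily μ f n g ρ u v) (h : bound μ f n g ρ u v = bound μ f n g ρ u w) :
    ∃ c : ℝ, c ≠ 0 ∧ IsLInv μ f n g ρ u (fun θ => c • v θ) := by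
  have hvv := hv.form_pos hf hρ
  have hww := (hw.inFamily hf hρ hu).form_pos hf hρ
  rw [bound_eq_form_div hf hρ hw hv, bound_eq_form_self hf hρ hw hu, div_eq_iff hvv.ne'] at h
  have hvw : form μ f n g ρ v w ≠ 0 := by
    intro h0
    rw [h0, zero_pow two_ne_zero] at h
    exact (mul_pos hww hvv).ne h
  -- The coefficient of the projection of `w` onto `v`. Equality in Cauchy-Schwarz makes the form
  -- vanish on the remainder `w - c v`, that is, at `t = -c`.
  set c := form μ f n g ρ v w / form μ f n g ρ v v with hc
  have hc0 : c ≠ 0 := div_ne_zero hvw hvv.ne'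
  have key := fun θ (hθ : θ ∈ I.interior Θ) =>
    formDensity_eq_zero hf hρ n hw.isField hv.isField (t := -c) (by
      rw [form_comm μ f n g ρ w v, hc]
      field_simp
      linarith) hθ
  have hs := hv.isField.smul hρ c
  have ediv : ∀ θ ∈ I.interior Θ, divρ g ρ (fun θ => c • v θ) θ = divρ g ρ w θ := fun θ hθ => by
    rw [divρ_smul hρ.smooth hv.isField.smooth c hθ]
    linarith [(key θ hθ).2]
  -- `v` was not assumed to be in the domain of `L`; the required regularity of its divergence is
  -- inherited from `w`.
  refine ⟨c, hc0, hs, ⟨hs.smooth, hw.ldiff.smooth_div.congr ediv⟩,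
    priorIntegrable_apply_smul hv.finite_A c, fun θ hθ z => ?_⟩
  have e : divρ g ρ (fun θ => c • v θ) =ᶠ[𝓝 θ] divρ g ρ w := by
    filter_upwards [interior_mem_nhds hθ] with θ' hθ'
    exact ediv θ' hθ'
  -- Either `n = 0`, or `w θ - c • v θ` is in the kernel of the Fisher form.
  have hF : n * fisher I μ f θ z (c • v θ) = n * fisher I μ f θ z (w θ) := by
    rcases mul_eq_zero.1 (key θ hθ).1 with h1 | h1
    · rw [h1, zero_mul, zero_mul]
    · have h2 := fisher_eq_zero_of_self hf hθ h1 z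
      have h3 := fisher_add_smul_right hf hθ 1 (-c) (w θ) (v θ) z
      have h4 := fisher_add_smul_right hf hθ c 0 (v θ) (v θ) z
      rw [one_smul, h2] at h3
      rw [zero_smul, add_zero] at h4
      rw [h4]
      congr 1
      linarith
  rw [← hw.eq θ hθ z, opL, opL, dif_congr e, hF]

/-- The preimage on the right depends on `v`: for a maximizer it is the multiple of `v` found in
`exists_isLInv_of_bound_eq`, not the preimage given at the start. The converse holds since the bound
is invariant under scaling. -/
theorem isLeastFavorable_iff (hf : IsRegularModel I μ f) (hρ : IsPriorDensity g ρ)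
    (hL : ∃ w, IsLInv μ f n g ρ u w) (hu : ∃ θ ∈ I.interior Θ, u θ ≠ 0) (v : VField I Θ) :
    IsLeastFavorable μ f n g ρ u v ↔
      ∃ (c : ℝ) (w : VField I Θ), c ≠ 0 ∧ IsLInv μ f n g ρ u w ∧ v = fun θ => c • w θ := by
  constructor
  · rintro ⟨hv, hmax⟩
    obtain ⟨w, hw⟩ := hL
    obtain ⟨c, hc, hcv⟩ := exists_isLInv_of_bound_eq hf hρ hw hu hv
      (le_antisymm (bound_le_bound hf hρ hw hu hv) (hmax w (hw.inFamily hf hρ hu)))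
    exact ⟨c⁻¹, _, inv_ne_zero hc, hcv, funext fun θ => (inv_smul_smul₀ hc (v θ)).symm⟩
  · rintro ⟨c, w, hc, hw, rfl⟩
    refine ⟨(hw.inFamily hf hρ hu).smul hρ hc, fun v' hv' => ?_⟩
    rw [bound_smul hρ hw.isField u hc]
    exact bound_le_bound hf hρ hw hu hv'

end Maximum

end GillLevit
end

theorem theorem1 {p : ℕ} {H : Type*} [TopologicalSpace H]
    (I : ModelWithCorners ℝ (EuclideanSpace ℝ (Fin p)) H)
    {Θ : Type*} [TopologicalSpace Θ] [ChartedSpace H Θ] [IsManifold I ∞ Θ]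
    [T2Space Θ] [SecondCountableTopology Θ] [MeasurableSpace Θ] [BorelSpace Θ]
    (g : GillLevit.Metric I Θ)
    {X : Type*} [MeasurableSpace X] (μ : Measure X) (f : Θ → X → ℝ)
    (hf : GillLevit.IsRegularModel I μ f) (n : ℕ)
    (ρ : Θ → ℝ) (hρ : GillLevit.IsPriorDensity g ρ) :
    -- `L` is linear
    (∀ (a b : ℝ) (v w : GillLevit.VField I Θ),
      GillLevit.LDiff g ρ v → GillLevit.LDiff g ρ w →
      GillLevit.LDiff g ρ (fun θ => a • v θ + b • w θ) ∧
      ∀ θ ∈ I.interior Θ, ∀ z : TangentSpace I θ,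
        GillLevit.opL μ f n g ρ (fun θ' => a • v θ' + b • w θ') θ z =
          a * GillLevit.opL μ f n g ρ v θ z + b * GillLevit.opL μ f n g ρ w θ z) ∧
    (∀ (a : ℝ) (v : GillLevit.VField I Θ), ∀ θ ∈ I.interior Θ, ∀ z z' : TangentSpace I θ,
      GillLevit.opL μ f n g ρ v θ (a • z + z') =
        a * GillLevit.opL μ f n g ρ v θ z + GillLevit.opL μ f n g ρ v θ z') ∧
    -- `L` is self-adjoint
    (∀ v w : GillLevit.VField I Θ,
      GillLevit.IsField μ f g ρ v → GillLevit.LDiff g ρ v →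
      GillLevit.IsField μ f g ρ w → GillLevit.LDiff g ρ w →
      GillLevit.PriorIntegrable g ρ (fun θ => GillLevit.opL μ f n g ρ w θ (v θ)) →
      GillLevit.PriorIntegrable g ρ (fun θ => GillLevit.opL μ f n g ρ v θ (w θ)) →
      GillLevit.priorMean g ρ (fun θ => GillLevit.opL μ f n g ρ w θ (v θ)) =
        GillLevit.priorMean g ρ (fun θ => GillLevit.opL μ f n g ρ v θ (w θ))) ∧
    -- `L` is positive-semidefinite
    (∀ v : GillLevit.VField I Θ, GillLevit.IsField μ f g ρ v → GillLevit.LDiff g ρ v →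
      GillLevit.PriorIntegrable g ρ (fun θ => GillLevit.opL μ f n g ρ v θ (v θ)) →
      0 ≤ GillLevit.priorMean g ρ (fun θ => GillLevit.opL μ f n g ρ v θ (v θ))) ∧
    -- the maximum of the bound and the maximizers, for `u = dβ ≠ 0` in the range of `L`
    ∀ β : Θ → ℝ, (∀ θ ∈ I.interior Θ, MDifferentiableAt I 𝓘(ℝ, ℝ) β θ) →
      (∃ θ ∈ I.interior Θ, GillLevit.dif (I := I) β θ ≠ 0) →
      (∃ w, GillLevit.IsLInv μ f n g ρ (GillLevit.dif β) w) →
      (∀ w, GillLevit.IsLInv μ f n g ρ (GillLevit.dif β) w →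
        IsGreatest (GillLevit.bound μ f n g ρ (GillLevit.dif β) ''
            {v | GillLevit.InFamily μ f n g ρ (GillLevit.dif β) v})
          (GillLevit.innerρ g ρ w (GillLevit.dif β))) ∧
      ∀ v, GillLevit.IsLeastFavorable μ f n g ρ (GillLevit.dif β) v ↔
        ∃ (c : ℝ) (w : GillLevit.VField I Θ), c ≠ 0 ∧
          GillLevit.IsLInv μ f n g ρ (GillLevit.dif β) w ∧ v = fun θ => c • w θ := by
  refine ⟨fun a b v w hv hw => ⟨hv.add_smul hρ.smooth hw a b, fun θ hθ z =>
      GillLevit.opL_add_smul hf n hρ.smooth hv hw a b hθ z⟩,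
    fun a v θ hθ z z' => GillLevit.opL_apply_smul_add hf n v a hθ z z',
    fun v w hv hvL hw hwL hi hi' => ?_, fun v hv hvL hi => ?_,
    fun β _ hu hL => ⟨fun w hw => GillLevit.isGreatest_bound hf hρ hw hu,
      GillLevit.isLeastFavorable_iff hf hρ hL hu⟩⟩
  · rw [GillLevit.priorMean_opL hf hρ n hv hw hwL hi,
      GillLevit.priorMean_opL hf hρ n hw hv hvL hi', GillLevit.form_comm]
  · rw [GillLevit.priorMean_opL hf hρ n hv hv hvL hi]
    exact GillLevit.form_self_nonneg hf hρ n v
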